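/- Let $M$ be a smooth (Hausdorff) $n$-dimensional manifold and let $(E,[\cdot,\cdot]_E,\sigma)$ be a Lie algebroid over $M$: $\pi:E\to M$ is a smooth real vector bundle of rank $m$, $\Gamma(E)$ carries a Lie bracket, and $\sigma:E\to TM$ is a smooth bundle map which induces a homomorphism of Lie algebras $\Gamma(E)\to\mathfrak X(M)$ and satisfies $[s,ft]_E=f[s,t]_E+(\sigma(s)f)\,t$. Let $\mathcal TE\to E$ be the prolongation of $E$, with fibres $$\mathcal T_wE=\{(u,X)\in E_{\pi(w)}\times T_wE \mid \sigma(u)=T_w\pi(X)\},$$ which is a Lie algebroid over $E$ with anchor $\sigma^1(u,X)=X$ and the bracket determined by $[(s\circ\pi,X),(t\circ\pi,Y)]=([s,t]_E\circ\pi,[X,Y])$ and the Leibniz rule. A section of $\mathcal TE$ acts on functions through $\sigma^1$; $d^E$ is the exterior derivative of $\mathcal TE$; vertical sections are those with first component $0$. For $a\in E_{\pi(w)}$ let $a^v_w\in T_wE$ be the velocity of $t\mapsto w+ta$ at $t=0$, and put $J(u,X)=(0,u^v_w)$ for $(u,X)\in\mathcal T_wE$ and $C(w)=(0,w^v_w)$.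 Let $U\subseteq E$ be open (for instance $U=E$ or $U=E$ without the zero section), and let $L:U\to\mathbb R$ be smooth and regular, i.e. the fibre Hessian $g_{\alpha\beta}=\partial^2L/\partial y^\alpha\partial y^\beta$ has rank $m$ at every point of $U$. Regard $g$ as a pseudo-Riemannian metric on vertical sections, $g(a^v,b^v)=g_{\alpha\beta}a^\alpha b^\beta$. Put $\theta_L=d^EL\circ J$, $\omega_L=d^E\theta_L$ and $E_L=C(L)-L$. Then: (i) there is exactly one smooth section $\mathcal S$ of $\mathcal TE$ over $U$ with $i_{\mathcal S}\omega_L=-d^EE_L$, and it is a semispray: $J\mathcal S=C$; (ii) $\mathcal N(\rho)=-[\mathcal S,J\rho]+J[\mathcal S,\rho]$ (that is, $\mathcal N=-\mathcal L_{\mathcal S}J$) is a nonlinear connection on $\mathcal TE$ over $U$, i.e. a smooth bundle endomorphism with $\mathcal N^2=\mathrm{Id}$ and $\ker(\mathrm{Id}+\mathcal N)$ the vertical subbundle; it is called the canonical nonlinear connection of $L$; (iii) $\mathcal N$ is metric: with $\mathrm h=\frac12(\mathrm{Id}+\mathcal N)$, $\mathrm v=\frac12(\mathrm{Id}-\mathcal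 N)$ and the dynamical covariant derivative $\nabla\rho=\mathrm h[\mathcal S,\mathrm h\rho]+\mathrm v[\mathcal S,\mathrm v\rho]$ one has $\nabla g=0$ on $U$, i.e. $$\mathcal S(g(\rho_1,\rho_2))=g(\nabla\rho_1,\rho_2)+g(\rho_1,\nabla\rho_2)$$ for all smooth vertical sections $\rho_1,\rho_2$ of $\mathcal TE$ over $U$. -/

import Mathlib

open Bundle Set Topology
open scoped Manifold ContDiff

noncomputable section

/-- The derivative `v(f)` of a real function on the base manifold along a tangent vector. -/
def baseDeriv {EM : Type*} [NormedAddCommGroup EM] [NormedSpace ℝ EM]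
    {M : Type*} [TopologicalSpace M] [ChartedSpace EM M]
    (f : M → ℝ) (x : M) (v : TangentSpace 𝓘(ℝ, EM) x) : ℝ :=
  mfderiv 𝓘(ℝ, EM) 𝓘(ℝ, ℝ) f x v

/-- A Lie algebroid structure on a smooth real vector bundle `E → M` (fibre model `F`) over a
manifold `M` modelled on `EM`: an anchor `σ : E → TM`, which is a smooth bundle map, and a Lie
bracket on the space `Γ(E)` of smooth sections, such that `σ` is a homomorphism of Lie algebras
and the Leibniz rule holds. -/
structure LieAlgebroid (EM : Type*) [NormedAddCommGroup EM] [NormedSpace ℝ EM]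
    {M : Type*} [TopologicalSpace M] [ChartedSpace EM M] [IsManifold 𝓘(ℝ, EM) ∞ M]
    (F : Type*) [NormedAddCommGroup F] [NormedSpace ℝ F]
    (E : M → Type*) [TopologicalSpace (TotalSpace F E)]
    [∀ x, AddCommGroup (E x)] [∀ x, Module ℝ (E x)] [∀ x, TopologicalSpace (E x)]
    [FiberBundle F E] [VectorBundle ℝ F E] where
  /-- the anchor, fibre by fibre -/
  anchor : ∀ x : M, E x →ₗ[ℝ] TangentSpace 𝓘(ℝ, EM) x
  anchor_smooth : ContMDiff (𝓘(ℝ, EM).prod 𝓘(ℝ, F)) 𝓘(ℝ, EM).tangent ∞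
    (fun u : TotalSpace F E ↦ (⟨u.proj, anchor u.proj u.2⟩ : TangentBundle 𝓘(ℝ, EM) M))
  /-- the bracket of smooth sections, an `ℝ`-bilinear operation -/
  bracket : Cₛ^∞⟮𝓘(ℝ, EM); F, E⟯ →ₗ[ℝ] Cₛ^∞⟮𝓘(ℝ, EM); F, E⟯ →ₗ[ℝ] Cₛ^∞⟮𝓘(ℝ, EM); F, E⟯
  bracket_skew : ∀ s t, bracket s t = - bracket t s
  jacobi : ∀ r s t,
    bracket r (bracket s t) + bracket s (bracket t r) + bracket t (bracket r s) = 0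
  anchor_bracket : ∀ s t, ∀ x : M, anchor x (bracket s t x) =
    VectorField.mlieBracket 𝓘(ℝ, EM) (fun y ↦ anchor y (s y)) (fun y ↦ anchor y (t y)) x
  /-- `[s, f t] = f [s, t] + (σ(s) f) t`; here `ft` is the section `f t` -/
  leibniz : ∀ (s t ft : Cₛ^∞⟮𝓘(ℝ, EM); F, E⟯) (f : M → ℝ),
    ContMDiff 𝓘(ℝ, EM) 𝓘(ℝ, ℝ) ∞ f → (∀ x, ft x = f x • t x) →
    ∀ x : M, bracket s ft x = f x • bracket s t x +
      baseDeriv f x (anchor x (s x)) • t x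

namespace LieAlgebroid

section VerticalLift

variable (EM : Type*) [NormedAddCommGroup EM] [NormedSpace ℝ EM]
  {M : Type*} [TopologicalSpace M] [ChartedSpace EM M]
  {F : Type*} [NormedAddCommGroup F] [NormedSpace ℝ F]
  {E : M → Type*} [TopologicalSpace (TotalSpace F E)]
  [∀ x, AddCommGroup (E x)] [∀ x, Module ℝ (E x)] [∀ x, TopologicalSpace (E x)]
  [FiberBundle F E]

/-- The vertical lift `a ↦ a_w^v`, from `E_x` to `T_w E` with `x = π(w)`: the velocity at `t = 0`
of the curve `t ↦ w + t a` in the fibre. -/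
def vlift (w : TotalSpace F E) (a : E w.proj) :
    TangentSpace (𝓘(ℝ, EM).prod 𝓘(ℝ, F)) w :=
  mfderiv 𝓘(ℝ, ℝ) (𝓘(ℝ, EM).prod 𝓘(ℝ, F))
    (fun t : ℝ ↦ (⟨w.proj, w.2 + t • a⟩ : TotalSpace F E)) 0 (1 : ℝ)

/-- The inverse of the vertical lift, defined on the vertical vectors at `w`. -/
def vcomp (w : TotalSpace F E) : TangentSpace (𝓘(ℝ, EM).prod 𝓘(ℝ, F)) w → E w.proj :=
  Function.invFun (vlift EM w)

/-- The derivative `X(f)` of a function on `E` in the direction of a tangent vector at `w`. -/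
def dirDeriv (f : TotalSpace F E → ℝ) (w : TotalSpace F E)
    (X : TangentSpace (𝓘(ℝ, EM).prod 𝓘(ℝ, F)) w) : ℝ :=
  mfderiv (𝓘(ℝ, EM).prod 𝓘(ℝ, F)) 𝓘(ℝ, ℝ) f w X

variable (F E) in
/-- Fields `w ↦ (u, X) ∈ E_{π(w)} × T_w E` on `E`, without further conditions. The sections of the
prolongation `𝒯E` are those which satisfy `IsSectionOn` below. -/
abbrev ProlField := ∀ w : TotalSpace F E, E w.proj × TangentSpace (𝓘(ℝ, EM).prod 𝓘(ℝ, F)) w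

/-- The vertical endomorphism `J(u, X) = (0, u^v)`. -/
def vertEndo (ρ : ProlField EM F E) : ProlField EM F E := fun w ↦ (0, vlift EM w (ρ w).1)

variable (F E) in
/-- The Euler section `C(w) = (0, w_w^v)`. -/
def euler : ProlField EM F E := fun w ↦ (0, vlift EM w w.2)

end VerticalLift

section FibreHessian

variable {M F : Type*} {E : M → Type*} [∀ x, AddCommGroup (E x)] [∀ x, Module ℝ (E x)]

/-- The Hessian `g_w(a, b)` of `L` along the fibre through `w`, with matrix
`g_{αβ} = ∂²L / ∂y^α ∂y^β` in linear fibre coordinates. -/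
def fibreHess (L : TotalSpace F E → ℝ) (w : TotalSpace F E) (a b : E w.proj) : ℝ :=
  deriv (fun s : ℝ ↦ deriv (fun t : ℝ ↦ L ⟨w.proj, w.2 + s • a + t • b⟩) 0) 0

/-- Regularity on `U`: the fibre Hessian has full rank at every point of `U`. -/
def IsRegularOn (L : TotalSpace F E → ℝ) (U : Set (TotalSpace F E)) : Prop :=
  ∀ w ∈ U, ∀ a : E w.proj, (∀ b : E w.proj, fibreHess L w a b = 0) → a = 0

end FibreHessian

section Prolongation

variable {EM : Type*} [NormedAddCommGroup EM] [NormedSpace ℝ EM] [FiniteDimensional ℝ EM]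
  {M : Type*} [TopologicalSpace M] [T2Space M] [ChartedSpace EM M] [IsManifold 𝓘(ℝ, EM) ∞ M]
  {F : Type*} [NormedAddCommGroup F] [NormedSpace ℝ F]
  {E : M → Type*} [TopologicalSpace (TotalSpace F E)]
  [∀ x, AddCommGroup (E x)] [∀ x, Module ℝ (E x)] [∀ x, TopologicalSpace (E x)]
  [FiberBundle F E] [VectorBundle ℝ F E] [ContMDiffVectorBundle ∞ F E 𝓘(ℝ, EM)]

variable (EM E) in
/-- Near `x`, a vector of the fibre model extends to a global smooth section of `E` which is
constant in the preferred trivialization at `x`. -/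
theorem exists_constSection (x : M) (f : F) : ∃ s : Cₛ^∞⟮𝓘(ℝ, EM); F, E⟯,
    ∀ᶠ y in 𝓝 x, s y = (trivializationAt F E x).symm y f := by
  set e := trivializationAt F E x with he
  have hx : e.baseSet ∈ 𝓝 x := e.open_baseSet.mem_nhds (mem_baseSet_trivializationAt F E x)
  obtain ⟨ψ, -, hψ⟩ := (SmoothBumpFunction.nhds_basis_tsupport (I := 𝓘(ℝ, EM)) x).mem_iff.1 hx
  have hsm : ContMDiffOn 𝓘(ℝ, EM) (𝓘(ℝ, EM).prod 𝓘(ℝ, F)) ∞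
      (fun y ↦ TotalSpace.mk' F y (e.symm y f)) e.baseSet := by
    rw [e.contMDiffOn_section_iff e.open_baseSet subset_rfl]
    refine (contMDiffOn_const (c := f)).congr fun y hy ↦ ?_
    rw [e.apply_mk_symm hy]
  refine ⟨⟨fun y ↦ ψ y • e.symm y f, ?_⟩, ?_⟩
  · exact ContMDiffOn.smul_section_of_tsupport ψ.contMDiff.contMDiffOn e.open_baseSet hψ hsm
  · filter_upwards [ψ.eventuallyEq_one] with y hy
    change ψ y • e.symm y f = _
    rw [hy, Pi.one_apply, one_smul]

variable (EM E) in
/-- A global smooth section which near `x` is the constant `f` in the trivialization at `x`. -/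
def constSection (x : M) (f : F) : Cₛ^∞⟮𝓘(ℝ, EM); F, E⟯ :=
  Classical.choose (exists_constSection EM E x f)

variable (A : LieAlgebroid EM F E)

/-- The fibre `𝒯_w E = {(u, X) ∈ E_x × T_w E | σ(u) = T_wπ(X)}`, `x = π(w)`, of the prolongation
of `E`. -/
def prolongation (w : TotalSpace F E) :
    Submodule ℝ (E w.proj × TangentSpace (𝓘(ℝ, EM).prod 𝓘(ℝ, F)) w) where
  carrier := {z | A.anchor w.proj z.1 = mfderiv (𝓘(ℝ, EM).prod 𝓘(ℝ, F)) 𝓘(ℝ, EM)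
    (TotalSpace.proj : TotalSpace F E → M) w z.2}
  add_mem' := by
    intro a b ha hb
    simp only [mem_ofPred_eq, Prod.fst_add, Prod.snd_add] at *
    rw [map_add, map_add, ha, hb]
  zero_mem' := by simp
  smul_mem' := by
    intro c a ha
    simp only [mem_ofPred_eq, Prod.smul_fst, Prod.smul_snd] at *
    rw [map_smul, map_smul, ha]

/-- `ρ` is a smooth section of the prolongation `𝒯E` over the open subset `U` of `E`. -/
structure IsSectionOn (U : Set (TotalSpace F E)) (ρ : ProlField EM F E) : Prop where
  mem : ∀ w ∈ U, ρ w ∈ A.prolongation w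
  smooth_fst : ContMDiffOn (𝓘(ℝ, EM).prod 𝓘(ℝ, F)) (𝓘(ℝ, EM).prod 𝓘(ℝ, F)) ∞
    (fun w ↦ (⟨w.proj, (ρ w).1⟩ : TotalSpace F E)) U
  smooth_snd : ContMDiffOn (𝓘(ℝ, EM).prod 𝓘(ℝ, F)) (𝓘(ℝ, EM).prod 𝓘(ℝ, F)).tangent ∞
    (fun w ↦ (⟨w, (ρ w).2⟩ : TangentBundle (𝓘(ℝ, EM).prod 𝓘(ℝ, F)) (TotalSpace F E))) U

/-- The first component `w ↦ (ρ w).1 ∈ E_{π(w)}` of a field, read in the preferred trivialization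
of `E` at `x`. -/
def fstCoord (x : M) (ρ : ProlField EM F E) (w : TotalSpace F E) : F :=
  (trivializationAt F E x ⟨w.proj, (ρ w).1⟩).2

/-- The derivative of `fstCoord x ρ` at `w` along a tangent vector `X` of `E` at `w`. -/
def fstCoordDeriv (x : M) (ρ : ProlField EM F E) (w : TotalSpace F E)
    (X : TangentSpace (𝓘(ℝ, EM).prod 𝓘(ℝ, F)) w) : F :=
  mfderiv (𝓘(ℝ, EM).prod 𝓘(ℝ, F)) 𝓘(ℝ, F) (fstCoord x ρ) w X

/-- The bracket `[ρ₁, ρ₂]` of sections of `𝒯E`. Its second component is the Lie bracket of the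
vector fields `X₁ = σ¹(ρ₁)`, `X₂ = σ¹(ρ₂)` on `E`. If the first components are `Z₁^α s_α`, `Z₂^α s_α`
in the frame `s_α` of the trivialization of `E` at `π(w)`, the first component of the bracket is
`(X₁(Z₂^γ) - X₂(Z₁^γ)) s_γ + Z₁^α Z₂^β [s_α, s_β]` at `w`. Hence for sections `(s ∘ π, X)` and
`(t ∘ π, Y)` with `s, t ∈ Γ(E)` the bracket is `([s, t] ∘ π, [X, Y])`. -/
def prolBracket (ρ₁ ρ₂ : ProlField EM F E) : ProlField EM F E := fun w ↦
  ((trivializationAt F E w.proj).symm w.proj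
      (fstCoordDeriv w.proj ρ₂ w (ρ₁ w).2 - fstCoordDeriv w.proj ρ₁ w (ρ₂ w).2) +
    A.bracket (constSection EM E w.proj (fstCoord w.proj ρ₁ w))
      (constSection EM E w.proj (fstCoord w.proj ρ₂ w)) w.proj,
   VectorField.mlieBracket (𝓘(ℝ, EM).prod 𝓘(ℝ, F)) (fun w' ↦ (ρ₁ w').2) (fun w' ↦ (ρ₂ w').2) w)

/-- A semispray on `U`: `J(S) = C`. -/
def IsSemisprayOn (U : Set (TotalSpace F E)) (S : ProlField EM F E) : Prop :=
  A.IsSectionOn U S ∧ ∀ w ∈ U, vertEndo EM S w = euler EM F E w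

/-- `P`, an operator on sections over `U`, is a nonlinear connection: a smooth bundle endomorphism
(that is, it maps sections to sections and is linear over smooth functions) with `P² = Id` and
`ker (Id + P)` equal to the vertical subbundle, which consists of the elements with first
component zero. -/
structure IsConnectionOn (U : Set (TotalSpace F E)) (P : ProlField EM F E → ProlField EM F E) : Prop where
  isSectionOn : ∀ ρ, A.IsSectionOn U ρ → A.IsSectionOn U (P ρ)
  map_add : ∀ ρ₁ ρ₂, A.IsSectionOn U ρ₁ → A.IsSectionOn U ρ₂ →
    ∀ w ∈ U, P (fun w' ↦ ρ₁ w' + ρ₂ w') w = P ρ₁ w + P ρ₂ w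
  map_smul : ∀ (f : TotalSpace F E → ℝ) (ρ : ProlField EM F E),
    ContMDiffOn (𝓘(ℝ, EM).prod 𝓘(ℝ, F)) 𝓘(ℝ, ℝ) ∞ f U → A.IsSectionOn U ρ →
    ∀ w ∈ U, P (fun w' ↦ f w' • ρ w') w = f w • P ρ w
  sq : ∀ ρ, A.IsSectionOn U ρ → ∀ w ∈ U, P (P ρ) w = ρ w
  ker : ∀ ρ, A.IsSectionOn U ρ → ∀ w ∈ U, (P ρ w = - ρ w ↔ (ρ w).1 = 0)

/-- The connection `𝒩 = -ℒ_S J` induced by `S`: `𝒩(ρ) = -[S, Jρ] + J[S, ρ]`. -/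
def conn (S ρ : ProlField EM F E) : ProlField EM F E := fun w ↦
  - A.prolBracket S (vertEndo EM ρ) w + vertEndo EM (A.prolBracket S ρ) w

/-- The horizontal projector `h = (Id + P) / 2` of a connection `P`. -/
def hproj (P : ProlField EM F E → ProlField EM F E) (ρ : ProlField EM F E) : ProlField EM F E := fun w ↦
  (1 / 2 : ℝ) • (ρ w + P ρ w)

/-- The vertical projector `v = (Id - P) / 2` of a connection `P`. -/
def vproj (P : ProlField EM F E → ProlField EM F E) (ρ : ProlField EM F E) : ProlField EM F E := fun w ↦
  (1 / 2 : ℝ) • (ρ w - P ρ w)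

/-- The dynamical covariant derivative of sections, `∇ρ = h[S, hρ] + v[S, vρ]`. -/
def dynCovDeriv (S : ProlField EM F E) (P : ProlField EM F E → ProlField EM F E) (ρ : ProlField EM F E) :
    ProlField EM F E := fun w ↦
  hproj P (A.prolBracket S (hproj P ρ)) w + vproj P (A.prolBracket S (vproj P ρ)) w

/-- The metric `g = g_{αβ} 𝒱^α ⊗ 𝒱^β` on vertical sections induced by `L`. -/
def metric (L : TotalSpace F E → ℝ) (ρ₁ ρ₂ : ProlField EM F E) (w : TotalSpace F E) : ℝ :=
  fibreHess L w (vcomp EM w (ρ₁ w).2) (vcomp EM w (ρ₂ w).2)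

/-- `(∇g)(ρ₁, ρ₂) = S(g(ρ₁, ρ₂)) - g(∇ρ₁, ρ₂) - g(ρ₁, ∇ρ₂)`. -/
def dynCovDerivMetric (L : TotalSpace F E → ℝ) (S : ProlField EM F E)
    (P : ProlField EM F E → ProlField EM F E) (ρ₁ ρ₂ : ProlField EM F E) (w : TotalSpace F E) : ℝ :=
  dirDeriv EM (metric L ρ₁ ρ₂) w (S w).2 - metric L (A.dynCovDeriv S P ρ₁) ρ₂ w -
    metric L ρ₁ (A.dynCovDeriv S P ρ₂) w

/-- The connection `P` is metric on `U`: `∇g = 0` on all vertical sections over `U`. -/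
def IsMetricOn (U : Set (TotalSpace F E)) (L : TotalSpace F E → ℝ) (S : ProlField EM F E)
    (P : ProlField EM F E → ProlField EM F E) : Prop :=
  ∀ ρ₁ ρ₂ : ProlField EM F E, A.IsSectionOn U ρ₁ → A.IsSectionOn U ρ₂ →
    (∀ w ∈ U, (ρ₁ w).1 = 0) → (∀ w ∈ U, (ρ₂ w).1 = 0) →
    ∀ w ∈ U, A.dynCovDerivMetric L S P ρ₁ ρ₂ w = 0

/-- The Cartan 1-section `θ_L = J(d^E L)`: `θ_L(ρ) = (d^E L)(Jρ)`. -/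
def cartanOne (L : TotalSpace F E → ℝ) (ρ : ProlField EM F E) (w : TotalSpace F E) : ℝ :=
  dirDeriv EM L w (vertEndo EM ρ w).2

/-- The Cartan 2-section `ω_L = d^E θ_L`:
`ω_L(ρ₁, ρ₂) = ρ₁(θ_L(ρ₂)) - ρ₂(θ_L(ρ₁)) - θ_L([ρ₁, ρ₂])`. -/
def cartanTwo (L : TotalSpace F E → ℝ) (ρ₁ ρ₂ : ProlField EM F E) (w : TotalSpace F E) : ℝ :=
  dirDeriv EM (cartanOne L ρ₂) w (ρ₁ w).2 - dirDeriv EM (cartanOne L ρ₁) w (ρ₂ w).2 -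
    cartanOne L (A.prolBracket ρ₁ ρ₂) w

variable (EM) in
/-- The energy `E_L = C(L) - L`, that is `y^α ∂L/∂y^α - L`. -/
def energy (L : TotalSpace F E → ℝ) (w : TotalSpace F E) : ℝ :=
  dirDeriv EM L w (euler EM F E w).2 - L w

/-- `S` is a section of `𝒯E` over `U` with `i_S ω_L = - d^E E_L`. The equality of these two forms
is tested on local sections. -/
def IsLagrangianSectionOn (U : Set (TotalSpace F E)) (L : TotalSpace F E → ℝ)
    (S : ProlField EM F E) : Prop :=
  A.IsSectionOn U S ∧ ∀ V ⊆ U, IsOpen V → ∀ ρ : ProlField EM F E, A.IsSectionOn V ρ →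
    ∀ w ∈ V, A.cartanTwo L S ρ w = - dirDeriv EM (energy EM L) w (ρ w).2

end Prolongation

end LieAlgebroid

end

/-! Everything is computed in coordinates `(x, y)` on `E` coming from a base chart and a
trivialization. A section of the prolongation becomes a pair `(z, v)`: `z` is its first component,
and its tangent vector is `(σ z, v)`, because the prolongation condition fixes the base part. Write
`p = ∂L/∂y`, `c` for the structure functions and `s` for the fibre component of `S`.

In `ω_L` the derivatives of the components cancel, leaving `dp(X₁) z₂ - dp(X₂) z₁ - p(c(z₁, z₂))`
(`cartanTwo_eq`), while `dE_L(X) = dp(X) y - dL(X_x, 0)` with `X_x` the base part of `X`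
(`dirDeriv_energy_eq`). Testing `i_S ω_L = -dE_L` on vertical sections shows that the Hessian `g`
annihilates `z_S - y`, so `S` is a semispray. What is left is the Euler-Lagrange equation, which is
linear in `s` with coefficient `g` (`isLagrangianSectionOn_iff`). Nondegeneracy of `g` then gives
uniqueness and smooth local solutions, and uniqueness glues them.

For a semispray, `𝒩(z, v) = (z, ∂s(z) + c(y, z) - v)` (`IsSprayCoord.conn_coord`), and the
connection axioms follow by linear algebra. On vertical sections `∇v = S(v) + ½(c(y, v) - ∂s(v))`
(`IsSprayCoord.dynCovDeriv_coord`). Metricity therefore says that `2 (S g)(a, b)` equals `g(c(y, a)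
- ∂s(a), b) + g(a, c(y, b) - ∂s(b))`. This is the part symmetric in `a, b` of the fibre derivative
of the Euler-Lagrange equation: the mixed `x, y` derivatives and `p(c(a, b))` are skew and drop out
(`EulerLagrangeAt.metric_identity`).

The bracket is defined at each point through the trivialization centred there. `fstC_prolBracket`
rewrites it in one fixed trivialization, which rests on locality and the Leibniz rule for the
bracket of `E` (`fibCoord_bracket`). -/

noncomputable section

/-! ### Vector fields in a chart -/

namespace ChartField

variable {G : Type*} [NormedAddCommGroup G] [NormedSpace ℝ G]
  {H : Type*} [TopologicalSpace H] {I : ModelWithCorners ℝ G H}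
  {N : Type*} [TopologicalSpace N] [ChartedSpace H N]

variable (I) in
/-- The derivative at `p` of the extended chart centred at `p₀`. -/
def chartD (p₀ p : N) : TangentSpace I p →L[ℝ] G :=
  mfderiv I 𝓘(ℝ, G) (extChartAt I p₀) p

variable (I) in
/-- The derivative at `q` of the inverse of the extended chart centred at `p₀`. -/
def chartDsymm (p₀ : N) (q : G) : G →L[ℝ] TangentSpace I ((extChartAt I p₀).symm q) :=
  mfderiv 𝓘(ℝ, G) I (extChartAt I p₀).symm q

/-- A vector field read in the extended chart centred at `p₀`. -/
def chartVec (p₀ : N) (X : ∀ p : N, TangentSpace I p) (q : G) : G :=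
  chartD I p₀ ((extChartAt I p₀).symm q) (X ((extChartAt I p₀).symm q))

set_option linter.unusedSectionVars false

variable [I.Boundaryless] [IsManifold I ∞ N] {p₀ p : N} {q : G}

theorem isOpen_target (p₀ : N) : IsOpen (extChartAt I p₀).target :=
  isOpen_extChartAt_target p₀

theorem contMDiffAt_chart_symm (hq : q ∈ (extChartAt I p₀).target) :
    ContMDiffAt 𝓘(ℝ, G) I ∞ (extChartAt I p₀).symm q :=
  (contMDiffOn_extChartAt_symm p₀).contMDiffAt ((isOpen_target p₀).mem_nhds hq)

theorem contMDiffAt_chart (hp : p ∈ (extChartAt I p₀).source) :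
    ContMDiffAt I 𝓘(ℝ, G) ∞ (extChartAt I p₀) p :=
  contMDiffAt_extChartAt' (by rwa [extChartAt_source] at hp)

theorem chartD_chartDsymm (hq : q ∈ (extChartAt I p₀).target) (v : G) :
    chartD I p₀ ((extChartAt I p₀).symm q) (chartDsymm I p₀ q v) = v := by
  have : IsManifold I 1 N := IsManifold.of_le (n := ∞) (by simp)
  have h := mfderiv_extChartAt_comp_mfderivWithin_extChartAt_symm (I := I) hq
  rw [I.range_eq_univ, mfderivWithin_univ] at h
  exact congrArg (fun T : G →L[ℝ] G ↦ T v) h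

theorem chartDsymm_chartD (hq : q ∈ (extChartAt I p₀).target)
    (v : TangentSpace I ((extChartAt I p₀).symm q)) :
    chartDsymm I p₀ q (chartD I p₀ ((extChartAt I p₀).symm q) v) = v := by
  have : IsManifold I 1 N := IsManifold.of_le (n := ∞) (by simp)
  have h := mfderivWithin_extChartAt_symm_comp_mfderiv_extChartAt (I := I) hq
  rw [I.range_eq_univ, mfderivWithin_univ] at h
  exact congrArg (fun T : TangentSpace I ((extChartAt I p₀).symm q) →L[ℝ]
    TangentSpace I ((extChartAt I p₀).symm q) ↦ T v) h

theorem chartD_injective (hp : p ∈ (extChartAt I p₀).source) :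
    Function.Injective (chartD I p₀ p) := by
  have : IsManifold I 1 N := IsManifold.of_le (n := ∞) (by simp)
  obtain ⟨e, he⟩ := isInvertible_mfderiv_extChartAt (I := I) hp
  intro a b hab
  have : e a = e b := by
    have h := hab
    unfold chartD at h
    rwa [← he] at h
  exact e.injective this

theorem mfderiv_eq_fderiv_chart {G' : Type*} [NormedAddCommGroup G'] [NormedSpace ℝ G']
    {f : N → G'} (hq : q ∈ (extChartAt I p₀).target)
    (hf : MDifferentiableAt I 𝓘(ℝ, G') f ((extChartAt I p₀).symm q))
    (v : TangentSpace I ((extChartAt I p₀).symm q)) :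
    (mfderiv I 𝓘(ℝ, G') f ((extChartAt I p₀).symm q) v : G') =
      fderiv ℝ (f ∘ (extChartAt I p₀).symm) q (chartD I p₀ ((extChartAt I p₀).symm q) v) := by
  have h := mfderiv_comp q hf
    ((contMDiffAt_chart_symm (I := I) hq).mdifferentiableAt (by simp))
  rw [mfderiv_eq_fderiv] at h
  have h2 := congrArg (fun T : G →L[ℝ] G' ↦ T (chartD I p₀ ((extChartAt I p₀).symm q) v)) h
  refine Eq.trans ?_ h2.symm
  change _ = (mfderiv I 𝓘(ℝ, G') f ((extChartAt I p₀).symm q))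
    (chartDsymm I p₀ q (chartD I p₀ ((extChartAt I p₀).symm q) v))
  rw [chartDsymm_chartD hq]

theorem mfderiv_eq_fderiv_chart_of_mem {G' : Type*} [NormedAddCommGroup G'] [NormedSpace ℝ G']
    {f : N → G'} (hp : p ∈ (extChartAt I p₀).source)
    (hf : MDifferentiableAt I 𝓘(ℝ, G') f p) (v : TangentSpace I p) :
    (mfderiv I 𝓘(ℝ, G') f p v : G') =
      fderiv ℝ (f ∘ (extChartAt I p₀).symm) (extChartAt I p₀ p) (chartD I p₀ p v) := by
  obtain ⟨q, hq, rfl⟩ : ∃ q ∈ (extChartAt I p₀).target, (extChartAt I p₀).symm q = p :=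
    ⟨_, (extChartAt I p₀).map_source hp, (extChartAt I p₀).left_inv hp⟩
  rw [(extChartAt I p₀).right_inv hq]
  exact mfderiv_eq_fderiv_chart hq hf v

theorem mdifferentiableAt_iff_chart {G' : Type*} [NormedAddCommGroup G'] [NormedSpace ℝ G']
    {f : N → G'} (hq : q ∈ (extChartAt I p₀).target) :
    MDifferentiableAt I 𝓘(ℝ, G') f ((extChartAt I p₀).symm q) ↔
      DifferentiableAt ℝ (f ∘ (extChartAt I p₀).symm) q := by
  constructor
  · intro h
    exact (h.comp q ((contMDiffAt_chart_symm (I := I) hq).mdifferentiableAt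
      (by simp))).differentiableAt
  · intro h
    have hp := (extChartAt I p₀).map_target hq
    have h2 : MDifferentiableAt I 𝓘(ℝ, G')
        ((f ∘ (extChartAt I p₀).symm) ∘ extChartAt I p₀) ((extChartAt I p₀).symm q) := by
      refine MDifferentiableAt.comp _ ?_ ((contMDiffAt_chart hp).mdifferentiableAt (by simp))
      rw [(extChartAt I p₀).right_inv hq]
      exact h.mdifferentiableAt
    refine h2.congr_of_eventuallyEq ?_
    filter_upwards [(isOpen_extChartAt_source (I := I) p₀).mem_nhds hp] with z hz
    exact congrArg f ((extChartAt I p₀).left_inv hz).symm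

theorem differentiableAt_chart_of_mem {G' : Type*} [NormedAddCommGroup G'] [NormedSpace ℝ G']
    {f : N → G'} (hp : p ∈ (extChartAt I p₀).source) (hf : MDifferentiableAt I 𝓘(ℝ, G') f p) :
    DifferentiableAt ℝ (f ∘ (extChartAt I p₀).symm) (extChartAt I p₀ p) := by
  refine (mdifferentiableAt_iff_chart ((extChartAt I p₀).map_source hp)).1 ?_
  rwa [(extChartAt I p₀).left_inv hp]

theorem contMDiffOn_iff_chart {G' : Type*} [NormedAddCommGroup G'] [NormedSpace ℝ G']
    {f : N → G'} {V : Set N} (hVo : IsOpen V) (hV : V ⊆ (extChartAt I p₀).source) :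
    ContMDiffOn I 𝓘(ℝ, G') ∞ f V ↔
      ContDiffOn ℝ ∞ (f ∘ (extChartAt I p₀).symm)
        ((extChartAt I p₀).target ∩ (extChartAt I p₀).symm ⁻¹' V) := by
  constructor
  · intro h
    rw [← contMDiffOn_iff_contDiffOn]
    intro q hq
    exact ((h.contMDiffAt (hVo.mem_nhds hq.2)).comp q
      (contMDiffAt_chart_symm hq.1)).contMDiffWithinAt
  · intro h p hp
    have h1 : (extChartAt I p₀).target ∩ (extChartAt I p₀).symm ⁻¹' V ∈ 𝓝 (extChartAt I p₀ p) := by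
      have := (continuousOn_extChartAt_symm (I := I) p₀).isOpen_inter_preimage (isOpen_target p₀) hVo
      refine this.mem_nhds ⟨(extChartAt I p₀).map_source (hV hp), ?_⟩
      rwa [mem_preimage, (extChartAt I p₀).left_inv (hV hp)]
    have h2 := (h.contDiffAt h1).contMDiffAt.comp p (contMDiffAt_chart (hV hp))
    refine (h2.congr_of_eventuallyEq ?_).contMDiffWithinAt
    filter_upwards [hVo.mem_nhds hp] with z hz
    exact congrArg f ((extChartAt I p₀).left_inv (hV hz)).symm

/-- Links the bundle notion of a smooth vector field with smoothness of its chart representative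
`chartVec`. -/
theorem trivializationAt_tangent_apply (hp : p ∈ (extChartAt I p₀).source)
    (v : TangentSpace I p) :
    (trivializationAt G (TangentSpace I) p₀ ⟨p, v⟩).2 = chartD I p₀ p v := by
  have : IsManifold I 1 N := IsManifold.of_le (n := ∞) (by simp)
  have hp' : p ∈ (chartAt H p₀).source := by rwa [extChartAt_source] at hp
  have h := TangentBundle.continuousLinearMapAt_trivializationAt (I := I) hp'
  have h2 := congrArg (fun T : TangentSpace I p →L[ℝ] G ↦ T v) h
  refine Eq.trans ?_ h2
  have hb : p ∈ (trivializationAt G (TangentSpace I) p₀).baseSet := by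
    rwa [TangentBundle.trivializationAt_baseSet]
  exact (Bundle.Trivialization.coe_linearMapAt_of_mem (R := ℝ) _ hb ▸ rfl)

theorem contMDiffAt_vectorField_iff (X : ∀ p : N, TangentSpace I p)
    (hp : p ∈ (extChartAt I p₀).source) :
    ContMDiffAt I I.tangent ∞ (fun p ↦ (⟨p, X p⟩ : TangentBundle I N)) p ↔
      ContMDiffAt I 𝓘(ℝ, G) ∞ (fun p ↦ chartD I p₀ p (X p)) p := by
  have hb : p ∈ (trivializationAt G (TangentSpace I) p₀).baseSet := by
    rwa [TangentBundle.trivializationAt_baseSet, ← extChartAt_source I]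
  rw [(trivializationAt G (TangentSpace I) p₀).contMDiffAt_section_iff hb]
  refine Filter.EventuallyEq.contMDiffAt_iff ?_
  filter_upwards [(isOpen_extChartAt_source (I := I) p₀).mem_nhds hp] with z hz
  exact trivializationAt_tangent_apply hz _

theorem contMDiffOn_vectorField_iff (X : ∀ p : N, TangentSpace I p) {V : Set N}
    (hVo : IsOpen V) (hV : V ⊆ (extChartAt I p₀).source) :
    ContMDiffOn I I.tangent ∞ (fun p ↦ (⟨p, X p⟩ : TangentBundle I N)) V ↔
      ContDiffOn ℝ ∞ (chartVec p₀ X)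
        ((extChartAt I p₀).target ∩ (extChartAt I p₀).symm ⁻¹' V) := by
  refine Iff.trans ?_ (contMDiffOn_iff_chart hVo hV (f := fun p ↦ chartD I p₀ p (X p)))
  refine forall₂_congr fun p hp ↦ ?_
  have h := contMDiffAt_vectorField_iff X (hV hp)
  exact ⟨fun h' ↦ (h.1 (h'.contMDiffAt (hVo.mem_nhds hp))).contMDiffWithinAt,
    fun h' ↦ (h.2 (h'.contMDiffAt (hVo.mem_nhds hp))).contMDiffWithinAt⟩

theorem mdifferentiableAt_vectorField_iff (X : ∀ p : N, TangentSpace I p)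
    (hq : q ∈ (extChartAt I p₀).target) :
    MDifferentiableAt I I.tangent (fun p ↦ (⟨p, X p⟩ : TangentBundle I N))
        ((extChartAt I p₀).symm q) ↔
      DifferentiableAt ℝ (chartVec p₀ X) q := by
  have : IsManifold I 1 N := IsManifold.of_le (n := ∞) (by simp)
  have hp := (extChartAt I p₀).map_target hq
  have hb : (extChartAt I p₀).symm q ∈ (trivializationAt G (TangentSpace I) p₀).baseSet := by
    rwa [TangentBundle.trivializationAt_baseSet, ← extChartAt_source I]
  rw [(trivializationAt G (TangentSpace I) p₀).mdifferentiableAt_section_iff I X hb,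
    mdifferentiableAt_iff_chart hq]
  refine Filter.EventuallyEq.differentiableAt_iff ?_
  filter_upwards [(isOpen_target (I := I) p₀).mem_nhds hq] with z hz
  exact trivializationAt_tangent_apply ((extChartAt I p₀).map_target hz) _

/-- The Lie bracket is natural under pullback by the inverse chart, and on the model space it is the
usual commutator of derivatives. -/
theorem chartVec_mlieBracket [CompleteSpace G] {X Y : ∀ p : N, TangentSpace I p}
    (hq : q ∈ (extChartAt I p₀).target) (hX : DifferentiableAt ℝ (chartVec p₀ X) q)
    (hY : DifferentiableAt ℝ (chartVec p₀ Y) q) :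
    chartVec p₀ (VectorField.mlieBracket I X Y) q =
      fderiv ℝ (chartVec p₀ Y) q (chartVec p₀ X q) -
        fderiv ℝ (chartVec p₀ X) q (chartVec p₀ Y q) := by
  have : IsManifold I (minSmoothness ℝ 3) N :=
    IsManifold.of_le (n := ∞) (by rw [minSmoothness_of_isRCLikeNormedField]; exact WithTop.coe_le_coe.2 le_top)
  -- Pulling back applies the inverse of the derivative of the inverse chart, which is the
  -- derivative of the chart.
  have key : ∀ Z : ∀ p : N, TangentSpace I p, ∀ z ∈ (extChartAt I p₀).target,
      VectorField.mpullback 𝓘(ℝ, G) I (extChartAt I p₀).symm Z z = chartVec p₀ Z z := by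
    intro Z z hz
    rw [VectorField.mpullback_apply]
    have hinv : (mfderiv 𝓘(ℝ, G) I (extChartAt I p₀).symm z).inverse =
        mfderiv I 𝓘(ℝ, G) (extChartAt I p₀) ((extChartAt I p₀).symm z) := by
      refine ContinuousLinearMap.inverse_eq ?_ ?_
      · ext v; exact chartDsymm_chartD hz v
      · ext v; exact chartD_chartDsymm hz v
    rw [hinv]; rfl
  have h := VectorField.mpullback_mlieBracket (n := ∞) (I := 𝓘(ℝ, G)) (I' := I)
    (f := (extChartAt I p₀).symm) (x₀ := q) (V := X) (W := Y)
    ((mdifferentiableAt_vectorField_iff X hq).2 hX)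
    ((mdifferentiableAt_vectorField_iff Y hq).2 hY) (contMDiffAt_chart_symm hq)
    (by rw [minSmoothness_of_isRCLikeNormedField]; exact WithTop.coe_le_coe.2 le_top)
  rw [key _ q hq] at h
  rw [h]
  -- The bracket at `q` depends on germs, so the identification is needed on a neighbourhood.
  have hev : ∀ Z : ∀ p : N, TangentSpace I p,
      VectorField.mpullback 𝓘(ℝ, G) I (extChartAt I p₀).symm Z =ᶠ[𝓝 q] chartVec p₀ Z := by
    intro Z
    filter_upwards [(isOpen_target (I := I) p₀).mem_nhds hq] with z hz using key Z z hz
  have h3 : VectorField.mlieBracketWithin 𝓘(ℝ, G) (chartVec p₀ X) (chartVec p₀ Y) univ q =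
      VectorField.lieBracketWithin ℝ (chartVec p₀ X) (chartVec p₀ Y) univ q :=
    congrFun (VectorField.mlieBracketWithin_eq_lieBracketWithin (s := univ)) q
  rw [VectorField.lieBracketWithin_univ] at h3
  exact ((hev X).mlieBracket_vectorField_eq (hev Y)).trans h3

end ChartField

end

noncomputable section

namespace LieAlgebroid

open ChartField

set_option linter.unusedSectionVars false

/-! ### Coordinates on the total space -/

section Coordinates

variable {EM : Type*} [NormedAddCommGroup EM] [NormedSpace ℝ EM] [FiniteDimensional ℝ EM]
  {M : Type*} [TopologicalSpace M] [T2Space M] [ChartedSpace EM M] [IsManifold 𝓘(ℝ, EM) ∞ M]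
  {F : Type*} [NormedAddCommGroup F] [NormedSpace ℝ F] [FiniteDimensional ℝ F]
  {E : M → Type*} [TopologicalSpace (TotalSpace F E)]
  [∀ x, AddCommGroup (E x)] [∀ x, Module ℝ (E x)] [∀ x, TopologicalSpace (E x)]
  [FiberBundle F E] [VectorBundle ℝ F E] [ContMDiffVectorBundle ∞ F E 𝓘(ℝ, EM)]

variable (F E) in
/-- The fibre coordinates over `x` in the preferred trivialization at `x₀`. -/
def fibCoord (x₀ x : M) : E x →ₗ[ℝ] F := (trivializationAt F E x₀).linearMapAt ℝ x

variable (F E) in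
/-- The vector over `x` with given fibre coordinates in the preferred trivialization at `x₀`. -/
def fibSymm (x₀ x : M) : F →ₗ[ℝ] E x := (trivializationAt F E x₀).symmₗ ℝ x

variable {x₀ x : M}

theorem fibCoord_eq (hx : x ∈ (trivializationAt F E x₀).baseSet) (a : E x) :
    (trivializationAt F E x₀ ⟨x, a⟩).2 = fibCoord F E x₀ x a := by
  rw [fibCoord, Bundle.Trivialization.coe_linearMapAt_of_mem _ hx]

theorem fibSymm_eq (hx : x ∈ (trivializationAt F E x₀).baseSet) (f : F) :
    (trivializationAt F E x₀).symm x f = fibSymm F E x₀ x f := by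
  rw [fibSymm, Bundle.Trivialization.symmₗ_apply _ hx]

theorem fibCoord_fibSymm (hx : x ∈ (trivializationAt F E x₀).baseSet) (f : F) :
    fibCoord F E x₀ x (fibSymm F E x₀ x f) = f :=
  Bundle.Trivialization.linearMapAt_symmₗ _ hx f

theorem fibSymm_fibCoord (hx : x ∈ (trivializationAt F E x₀).baseSet) (a : E x) :
    fibSymm F E x₀ x (fibCoord F E x₀ x a) = a :=
  Bundle.Trivialization.symmₗ_linearMapAt _ hx a

theorem fibCoord_injective (hx : x ∈ (trivializationAt F E x₀).baseSet) :
    Function.Injective (fibCoord F E x₀ x) :=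
  Function.LeftInverse.injective (fibSymm_fibCoord hx)

variable (EM) in
/-- The extended chart of the total space centred at `w₀`. -/
abbrev totChart (w₀ : TotalSpace F E) : PartialEquiv (TotalSpace F E) (EM × F) :=
  extChartAt (𝓘(ℝ, EM).prod 𝓘(ℝ, F)) w₀

variable (EM) in
/-- The extended chart of the base. -/
abbrev baseChart (x₀ : M) : PartialEquiv M EM := extChartAt 𝓘(ℝ, EM) x₀

variable {w₀ w : TotalSpace F E} {q : EM × F}

theorem mem_totChart_source :
    w ∈ (totChart EM w₀).source ↔ w.proj ∈ (baseChart EM w₀.proj).source ∧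
      w.proj ∈ (trivializationAt F E w₀.proj).baseSet := by
  rw [totChart, FiberBundle.extChartAt, PartialEquiv.trans_source]
  simp only [mem_inter_iff, mem_preimage, PartialEquiv.prod_source, mem_prod,
    PartialEquiv.refl_source, mem_univ, and_true]
  change w ∈ (trivializationAt F E w₀.proj).source ∧
    (trivializationAt F E w₀.proj w).1 ∈ _ ↔ _
  rw [Bundle.Trivialization.mem_source, and_comm]
  refine and_congr_left fun h ↦ ?_
  rw [Bundle.Trivialization.coe_fst' _ h]

theorem mem_totChart_target :
    q ∈ (totChart EM w₀).target ↔ q.1 ∈ (baseChart EM w₀.proj).target ∧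
      (baseChart EM w₀.proj).symm q.1 ∈ (trivializationAt F E w₀.proj).baseSet := by
  rw [totChart, FiberBundle.extChartAt_target]
  simp

theorem totChart_apply (hw : w ∈ (totChart EM w₀).source) :
    totChart EM w₀ w = (baseChart EM w₀.proj w.proj, fibCoord F E w₀.proj w.proj w.2) := by
  have h := (mem_totChart_source.1 hw).2
  rw [totChart, FiberBundle.extChartAt, ← fibCoord_eq h]
  change (baseChart EM w₀.proj (trivializationAt F E w₀.proj w).1,
    (trivializationAt F E w₀.proj w).2) = _
  rw [Bundle.Trivialization.coe_fst' _ h]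

theorem totChart_symm (hq : q ∈ (totChart EM w₀).target) :
    (totChart EM w₀).symm q = ⟨(baseChart EM w₀.proj).symm q.1,
      fibSymm F E w₀.proj ((baseChart EM w₀.proj).symm q.1) q.2⟩ := by
  have h := (mem_totChart_target.1 hq).2
  rw [← fibSymm_eq h]
  rw [totChart, FiberBundle.extChartAt]
  exact ((trivializationAt F E w₀.proj).mk_symm h q.2).symm

theorem totChart_symm_proj (hq : q ∈ (totChart EM w₀).target) :
    ((totChart EM w₀).symm q).proj = (baseChart EM w₀.proj).symm q.1 := by
  rw [totChart_symm hq]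

theorem symm_proj_mem_baseSet (hq : q ∈ (totChart EM w₀).target) :
    ((totChart EM w₀).symm q).proj ∈ (trivializationAt F E w₀.proj).baseSet :=
  (mem_totChart_source.1 ((totChart EM w₀).map_target hq)).2

theorem fibCoord_totChart_symm (hq : q ∈ (totChart EM w₀).target) :
    fibCoord F E w₀.proj _ ((totChart EM w₀).symm q).2 = q.2 := by
  have h := totChart_apply ((totChart EM w₀).map_target hq)
  rw [(totChart EM w₀).right_inv hq] at h
  exact (congrArg Prod.snd h).symm

theorem baseChart_totChart_symm (hq : q ∈ (totChart EM w₀).target) :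
    baseChart EM w₀.proj ((totChart EM w₀).symm q).proj = q.1 := by
  rw [totChart_symm_proj hq]
  exact (baseChart EM w₀.proj).right_inv (mem_totChart_target.1 hq).1

/-- The derivative of the chart of the total space. -/
abbrev totD (w₀ w : TotalSpace F E) :
    TangentSpace (𝓘(ℝ, EM).prod 𝓘(ℝ, F)) w →L[ℝ] EM × F :=
  chartD (𝓘(ℝ, EM).prod 𝓘(ℝ, F)) w₀ w

/-- In these charts the bundle projection is `Prod.fst`. This turns the prolongation condition into
an equation for the base component. -/
theorem chartD_mfderiv_proj (hw : w ∈ (totChart EM w₀).source)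
    (X : TangentSpace (𝓘(ℝ, EM).prod 𝓘(ℝ, F)) w) :
    chartD 𝓘(ℝ, EM) w₀.proj w.proj (mfderiv (𝓘(ℝ, EM).prod 𝓘(ℝ, F)) 𝓘(ℝ, EM)
      (TotalSpace.proj : TotalSpace F E → M) w X) = (totD w₀ w X).1 := by
  have hp : MDifferentiableAt (𝓘(ℝ, EM).prod 𝓘(ℝ, F)) 𝓘(ℝ, EM)
      (TotalSpace.proj : TotalSpace F E → M) w :=
    ((contMDiff_proj (n := ∞) E) w).mdifferentiableAt (by simp)
  have hb : MDifferentiableAt 𝓘(ℝ, EM) 𝓘(ℝ, EM) (baseChart EM w₀.proj) w.proj :=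
    (contMDiffAt_chart (mem_totChart_source.1 hw).1).mdifferentiableAt (by simp)
  have ht : MDifferentiableAt (𝓘(ℝ, EM).prod 𝓘(ℝ, F)) 𝓘(ℝ, EM × F) (totChart EM w₀) w :=
    (contMDiffAt_chart hw).mdifferentiableAt (by simp)
  have h1 := mfderiv_comp w hb hp
  have hf : MDifferentiableAt 𝓘(ℝ, EM × F) 𝓘(ℝ, EM) (Prod.fst : EM × F → EM) (totChart EM w₀ w) :=
    differentiableAt_fst.mdifferentiableAt
  have h2 := mfderiv_comp w hf ht
  have heq : (baseChart EM w₀.proj) ∘ (TotalSpace.proj : TotalSpace F E → M) =ᶠ[𝓝 w]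
      (Prod.fst : EM × F → EM) ∘ totChart EM w₀ := by
    filter_upwards [(isOpen_extChartAt_source w₀).mem_nhds hw] with z hz
    have := totChart_apply hz
    exact (congrArg Prod.fst this).symm
  rw [heq.mfderiv_eq, h2, mfderiv_eq_fderiv, fderiv_fst] at h1
  exact (congrArg (fun T : EM × F →L[ℝ] EM ↦ T X) h1).symm

/-- The chart is linear on fibres, so vertical lifts and fibre Hessians can be computed along
straight lines. -/
theorem totChart_fibre_line (hw : w ∈ (totChart EM w₀).source) (a : E w.proj) (t : ℝ) :
    totChart EM w₀ ⟨w.proj, w.2 + t • a⟩ =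
      totChart EM w₀ w + t • ((0, fibCoord F E w₀.proj w.proj a) : EM × F) := by
  have h : (⟨w.proj, w.2 + t • a⟩ : TotalSpace F E) ∈ (totChart EM w₀).source := by
    have h' := mem_totChart_source.1 hw
    exact mem_totChart_source.2 h'
  rw [totChart_apply h, totChart_apply hw]
  simp

theorem contMDiffAt_fibre_line (w : TotalSpace F E) (a : E w.proj) (t : ℝ) :
    ContMDiffAt 𝓘(ℝ, ℝ) (𝓘(ℝ, EM).prod 𝓘(ℝ, F)) ∞
      (fun t : ℝ ↦ (⟨w.proj, w.2 + t • a⟩ : TotalSpace F E)) t := by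
  rw [contMDiffAt_totalSpace]
  refine ⟨contMDiffAt_const, ?_⟩
  have h : ∀ t : ℝ, (trivializationAt F E w.proj ⟨w.proj, w.2 + t • a⟩).2 =
      fibCoord F E w.proj w.proj w.2 + t • fibCoord F E w.proj w.proj a := fun t ↦ by
    rw [fibCoord_eq (mem_baseSet_trivializationAt F E w.proj), map_add, map_smul]
  simp only [h]
  rw [contMDiffAt_iff_contDiffAt]
  fun_prop

theorem totD_vlift (hw : w ∈ (totChart EM w₀).source) (a : E w.proj) :
    totD w₀ w (vlift EM w a) = (0, fibCoord F E w₀.proj w.proj a) := by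
  have hw0 : (⟨w.proj, w.2 + (0 : ℝ) • a⟩ : TotalSpace F E) = w := by
    rw [zero_smul, add_zero]
  have hγ : MDifferentiableAt 𝓘(ℝ, ℝ) (𝓘(ℝ, EM).prod 𝓘(ℝ, F))
      (fun t : ℝ ↦ (⟨w.proj, w.2 + t • a⟩ : TotalSpace F E)) 0 :=
    (contMDiffAt_fibre_line w a 0).mdifferentiableAt (by simp)
  have ht : MDifferentiableAt (𝓘(ℝ, EM).prod 𝓘(ℝ, F)) 𝓘(ℝ, EM × F) (totChart EM w₀) w :=
    (contMDiffAt_chart hw).mdifferentiableAt (by simp)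
  have h1 := mfderiv_comp_of_eq ht hγ hw0
  have h2 : (totChart EM w₀) ∘ (fun t : ℝ ↦ (⟨w.proj, w.2 + t • a⟩ : TotalSpace F E)) =
      fun t : ℝ ↦ totChart EM w₀ w + t • ((0, fibCoord F E w₀.proj w.proj a) : EM × F) :=
    funext fun t ↦ totChart_fibre_line hw a t
  have h3 : HasDerivAt (fun t : ℝ ↦ totChart EM w₀ w +
      t • ((0, fibCoord F E w₀.proj w.proj a) : EM × F))
      ((0, fibCoord F E w₀.proj w.proj a) : EM × F) 0 := by
    simpa using ((hasDerivAt_id (0 : ℝ)).smul_const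
      ((0, fibCoord F E w₀.proj w.proj a) : EM × F)).const_add (totChart EM w₀ w)
  rw [h2, mfderiv_eq_fderiv] at h1
  have h4 := congrArg (fun T : ℝ →L[ℝ] EM × F ↦ T 1) h1
  have h5 : (fderiv ℝ (fun t : ℝ ↦ totChart EM w₀ w +
      t • ((0, fibCoord F E w₀.proj w.proj a) : EM × F)) 0) 1 =
      ((0, fibCoord F E w₀.proj w.proj a) : EM × F) := by
    rw [h3.hasFDerivAt.fderiv]; simp
  -- The base point `w.2 + 0 • a` is only propositionally `w.2`. Giving the derivative a codomain
  -- independent of the point allows the transport.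
  let D : TotalSpace F E → EM × F →L[ℝ] EM × F := fun p ↦ totD w₀ p
  have h6 : D ⟨w.proj, w.2 + (0 : ℝ) • a⟩ = D w := congrArg D hw0
  refine Eq.trans ?_ (h4.symm.trans h5)
  exact (congrArg (fun T : EM × F →L[ℝ] EM × F ↦ T (vlift EM w a)) h6).symm

theorem vlift_injective (w : TotalSpace F E) : Function.Injective (vlift EM w) := by
  intro a b hab
  have hw : w ∈ (totChart EM w).source := mem_extChartAt_source w
  have h := congrArg (totD w w) hab
  rw [totD_vlift hw, totD_vlift hw] at h
  exact fibCoord_injective (mem_baseSet_trivializationAt F E w.proj) (congrArg Prod.snd h)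

theorem eq_vlift (hw : w ∈ (totChart EM w₀).source)
    {X : TangentSpace (𝓘(ℝ, EM).prod 𝓘(ℝ, F)) w} (hX : (totD w₀ w X).1 = 0) :
    X = vlift EM w (fibSymm F E w₀.proj w.proj (totD w₀ w X).2) := by
  apply chartD_injective hw
  rw [totD_vlift hw, fibCoord_fibSymm (mem_totChart_source.1 hw).2, ← hX]

/-- `vcomp` is a genuine inverse only on the range of the injective map `vlift`, which is why the
tangent vector has to be vertical. -/
theorem fibCoord_vcomp (hw : w ∈ (totChart EM w₀).source)
    {X : TangentSpace (𝓘(ℝ, EM).prod 𝓘(ℝ, F)) w} (hX : (totD w₀ w X).1 = 0) :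
    fibCoord F E w₀.proj w.proj (vcomp EM w X) = (totD w₀ w X).2 := by
  have h := eq_vlift hw hX
  have h2 : vcomp EM w X = fibSymm F E w₀.proj w.proj (totD w₀ w X).2 := by
    conv_lhs => rw [h]
    exact Function.leftInverse_invFun (vlift_injective w) _
  rw [h2, fibCoord_fibSymm (mem_totChart_source.1 hw).2]

end Coordinates

end LieAlgebroid

end

noncomputable section

namespace LieAlgebroid

open ChartField

set_option linter.unusedSectionVars false

/-! ### The bracket of sections in a local frame -/

section Frame

variable {EM : Type*} [NormedAddCommGroup EM] [NormedSpace ℝ EM] [FiniteDimensional ℝ EM]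
  {M : Type*} [TopologicalSpace M] [T2Space M] [ChartedSpace EM M] [IsManifold 𝓘(ℝ, EM) ∞ M]
  {F : Type*} [NormedAddCommGroup F] [NormedSpace ℝ F] [FiniteDimensional ℝ F]
  {E : M → Type*} [TopologicalSpace (TotalSpace F E)]
  [∀ x, AddCommGroup (E x)] [∀ x, Module ℝ (E x)] [∀ x, TopologicalSpace (E x)]
  [FiberBundle F E] [VectorBundle ℝ F E] [ContMDiffVectorBundle ∞ F E 𝓘(ℝ, EM)]
  (A : LieAlgebroid EM F E)

/-- The product of a section with a smooth function. -/
def smulSection (f : M → ℝ) (hf : ContMDiff 𝓘(ℝ, EM) 𝓘(ℝ, ℝ) ∞ f)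
    (s : Cₛ^∞⟮𝓘(ℝ, EM); F, E⟯) : Cₛ^∞⟮𝓘(ℝ, EM); F, E⟯ :=
  ⟨fun x ↦ f x • s x, hf.smul_section s.contMDiff⟩

/-- If `ψ` is a bump function at `x` supported where `u` vanishes, then `u = (1 - ψ) u`. Both terms
of the Leibniz rule vanish at `x`, one since `ψ x = 1`, the other since `u x = 0`. -/
theorem bracket_eq_zero_of_eventually (s u : Cₛ^∞⟮𝓘(ℝ, EM); F, E⟯) {x : M}
    (hu : ∀ᶠ y in 𝓝 x, u y = 0) : A.bracket s u x = 0 := by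
  obtain ⟨ψ, -, hψ⟩ := (SmoothBumpFunction.nhds_basis_tsupport (I := 𝓘(ℝ, EM)) x).mem_iff.1 hu
  have h := A.leibniz s u u (fun y ↦ 1 - ψ y) (contMDiff_const.sub ψ.contMDiff) (fun y ↦ by
    by_cases hy : y ∈ tsupport ψ
    · have : u y = 0 := hψ hy
      rw [this, smul_zero]
    · rw [image_eq_zero_of_notMem_tsupport hy, sub_zero, one_smul]) x
  have hx : u x = 0 := hu.self_of_nhds
  rw [h, hx, smul_zero, add_zero, ψ.eq_one, sub_self, zero_smul]

theorem bracket_congr_right (s : Cₛ^∞⟮𝓘(ℝ, EM); F, E⟯) {t t' : Cₛ^∞⟮𝓘(ℝ, EM); F, E⟯} {x : M}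
    (h : ∀ᶠ y in 𝓝 x, t y = t' y) : A.bracket s t x = A.bracket s t' x := by
  have h1 := A.bracket_eq_zero_of_eventually s (t - t') (x := x) (by
    filter_upwards [h] with y hy
    rw [ContMDiffSection.coe_sub, Pi.sub_apply, hy, sub_self])
  rw [map_sub, ContMDiffSection.coe_sub, Pi.sub_apply] at h1
  exact sub_eq_zero.1 h1

variable (EM F E) in
/-- The points near which the sections extending the standard basis form the frame of the preferred
trivialization at `x₀`. -/
def frameSet (x₀ : M) : Set M :=
  {x | ∀ᶠ y in 𝓝 x, y ∈ (trivializationAt F E x₀).baseSet ∧ y ∈ (baseChart EM x₀).source ∧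
    ∀ i, constSection EM E x₀ (Module.finBasis ℝ F i) y =
      fibSymm F E x₀ y (Module.finBasis ℝ F i)}

theorem isOpen_frameSet (x₀ : M) : IsOpen (frameSet EM F E x₀) :=
  isOpen_setOfPred_eventually_nhds

theorem mem_frameSet_self (x₀ : M) : x₀ ∈ frameSet EM F E x₀ := by
  have hx : (trivializationAt F E x₀).baseSet ∈ 𝓝 x₀ :=
    (trivializationAt F E x₀).open_baseSet.mem_nhds (mem_baseSet_trivializationAt F E x₀)
  have h2 : ∀ i, ∀ᶠ y in 𝓝 x₀, constSection EM E x₀ (Module.finBasis ℝ F i) y =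
      (trivializationAt F E x₀).symm y (Module.finBasis ℝ F i) := fun i ↦
    Classical.choose_spec (exists_constSection EM E x₀ (Module.finBasis ℝ F i))
  have h3 : (baseChart EM x₀).source ∈ 𝓝 x₀ := extChartAt_source_mem_nhds x₀
  filter_upwards [hx, Filter.eventually_all.2 h2, h3] with y hy hy2 hy3
  exact ⟨hy, hy3, fun i ↦ by rw [hy2 i, fibSymm_eq hy]⟩

theorem frameSet_subset_baseSet {x₀ x : M} (hx : x ∈ frameSet EM F E x₀) :
    x ∈ (trivializationAt F E x₀).baseSet :=
  (Filter.Eventually.self_of_nhds hx).1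

theorem frameSet_subset_source {x₀ x : M} (hx : x ∈ frameSet EM F E x₀) :
    x ∈ (baseChart EM x₀).source :=
  (Filter.Eventually.self_of_nhds hx).2.1

theorem contMDiffAt_fibCoord_section (s : Cₛ^∞⟮𝓘(ℝ, EM); F, E⟯) {x₀ x : M}
    (hx : x ∈ (trivializationAt F E x₀).baseSet) :
    ContMDiffAt 𝓘(ℝ, EM) 𝓘(ℝ, F) ∞ (fun y ↦ fibCoord F E x₀ y (s y)) x := by
  have h := ((trivializationAt F E x₀).contMDiffAt_section_iff hx).1 (s.contMDiff x)
  refine h.congr_of_eventuallyEq ?_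
  filter_upwards [(trivializationAt F E x₀).open_baseSet.mem_nhds hx] with y hy
  exact (fibCoord_eq hy _).symm

/-- The derivative of the fibre coordinates of a section of `E`. -/
def secDeriv (x₀ : M) (s : Cₛ^∞⟮𝓘(ℝ, EM); F, E⟯) (x : M) (v : TangentSpace 𝓘(ℝ, EM) x) : F :=
  mfderiv 𝓘(ℝ, EM) 𝓘(ℝ, F) (fun y ↦ fibCoord F E x₀ y (s y)) x v

theorem secDeriv_add (x₀ : M) (s : Cₛ^∞⟮𝓘(ℝ, EM); F, E⟯) (x : M)
    (v v' : TangentSpace 𝓘(ℝ, EM) x) :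
    secDeriv x₀ s x (v + v') = secDeriv x₀ s x v + secDeriv x₀ s x v' :=
  map_add (mfderiv 𝓘(ℝ, EM) 𝓘(ℝ, F) (fun y ↦ fibCoord F E x₀ y (s y)) x) v v'

theorem secDeriv_smul (x₀ : M) (s : Cₛ^∞⟮𝓘(ℝ, EM); F, E⟯) (x : M) (c : ℝ)
    (v : TangentSpace 𝓘(ℝ, EM) x) :
    secDeriv x₀ s x (c • v) = c • secDeriv x₀ s x v :=
  map_smul (mfderiv 𝓘(ℝ, EM) 𝓘(ℝ, F) (fun y ↦ fibCoord F E x₀ y (s y)) x) c v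

/-- By locality `t` may be replaced by a combination of the frame sections with globally smooth
coefficients; the Leibniz rule applied to each term yields the derivative of the coordinates of `t`.
-/
theorem fibCoord_bracket_expand (s t : Cₛ^∞⟮𝓘(ℝ, EM); F, E⟯) {x₀ x : M}
    (hx : x ∈ frameSet EM F E x₀) :
    fibCoord F E x₀ x (A.bracket s t x) =
      ∑ j, (Module.finBasis ℝ F).repr (fibCoord F E x₀ x (t x)) j •
        fibCoord F E x₀ x (A.bracket s (constSection EM E x₀ (Module.finBasis ℝ F j)) x) +
      secDeriv x₀ t x (A.anchor x (s x)) := by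
  set b := Module.finBasis ℝ F
  have hb := frameSet_subset_baseSet hx
  obtain ⟨ψ, -, hψ⟩ := (SmoothBumpFunction.nhds_basis_tsupport (I := 𝓘(ℝ, EM)) x).mem_iff.1
    ((trivializationAt F E x₀).open_baseSet.mem_nhds hb)
  let φ : Fin (Module.finrank ℝ F) → F →L[ℝ] ℝ := fun j ↦ LinearMap.toContinuousLinearMap (b.coord j)
  -- The coordinates of `t` exist only over the trivialization domain; the bump function makes them
  -- global without changing them near `x`.
  let f : Fin (Module.finrank ℝ F) → M → ℝ := fun j y ↦ ψ y • φ j (fibCoord F E x₀ y (t y))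
  have hf : ∀ j, ContMDiff 𝓘(ℝ, EM) 𝓘(ℝ, ℝ) ∞ (f j) := fun j ↦
    contMDiff_of_tsupport fun y hy ↦ ψ.contMDiffAt.smul
      ((φ j).contDiff.contMDiff.contMDiffAt.comp y (contMDiffAt_fibCoord_section t
        (hψ (tsupport_smul_subset_left _ _ hy))))
  have hfe : ∀ j, f j =ᶠ[𝓝 x] fun y ↦ φ j (fibCoord F E x₀ y (t y)) := fun j ↦ by
    filter_upwards [ψ.eventuallyEq_one] with y hy
    simp only [f, hy, Pi.one_apply, one_smul]
  let t' : Cₛ^∞⟮𝓘(ℝ, EM); F, E⟯ := ∑ j, smulSection (f j) (hf j) (constSection EM E x₀ (b j))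
  have ht' : ∀ᶠ y in 𝓝 x, t y = t' y := by
    filter_upwards [Filter.eventually_all.2 hfe, hx] with y hy hy2
    have h1 : t' y = ∑ j, f j y • constSection EM E x₀ (b j) y := by
      simp only [t']
      have : ∀ S : Finset (Fin (Module.finrank ℝ F)),
          (∑ j ∈ S, smulSection (f j) (hf j) (constSection EM E x₀ (b j))) y =
          ∑ j ∈ S, f j y • constSection EM E x₀ (b j) y := by
        intro S
        induction S using Finset.induction_on with
        | empty => simp
        | insert a S ha ih =>
          rw [Finset.sum_insert ha, Finset.sum_insert ha, ContMDiffSection.coe_add, Pi.add_apply, ih]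
          rfl
      exact this _
    rw [h1]
    apply fibCoord_injective hy2.1
    rw [map_sum]
    conv_lhs => rw [← b.sum_repr (fibCoord F E x₀ y (t y))]
    refine Finset.sum_congr rfl fun j _ ↦ ?_
    rw [map_smul, hy2.2.2 j, fibCoord_fibSymm hy2.1, hy j]
    rfl
  have hd : ∀ j, baseDeriv (f j) x (A.anchor x (s x)) =
      b.repr (secDeriv x₀ t x (A.anchor x (s x))) j := by
    intro j
    unfold baseDeriv secDeriv
    rw [(hfe j).mfderiv_eq]
    have h2 := mfderiv_comp x (g := φ j) (f := fun y ↦ fibCoord F E x₀ y (t y))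
      (φ j).differentiableAt.mdifferentiableAt
      ((contMDiffAt_fibCoord_section t hb).mdifferentiableAt (by simp))
    rw [mfderiv_eq_fderiv, (φ j).fderiv] at h2
    exact congrArg (fun T : EM →L[ℝ] ℝ ↦ T (A.anchor x (s x))) h2
  rw [A.bracket_congr_right s ht']
  have hsum : A.bracket s t' x = ∑ j, (f j x • A.bracket s (constSection EM E x₀ (b j)) x +
      baseDeriv (f j) x (A.anchor x (s x)) • constSection EM E x₀ (b j) x) := by
    have : ∀ S : Finset (Fin (Module.finrank ℝ F)),
        A.bracket s (∑ j ∈ S, smulSection (f j) (hf j) (constSection EM E x₀ (b j))) x =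
        ∑ j ∈ S, (f j x • A.bracket s (constSection EM E x₀ (b j)) x +
          baseDeriv (f j) x (A.anchor x (s x)) • constSection EM E x₀ (b j) x) := by
      intro S
      induction S using Finset.induction_on with
      | empty => simp
      | insert a S ha ih =>
        rw [Finset.sum_insert ha, Finset.sum_insert ha, map_add, ContMDiffSection.coe_add,
          Pi.add_apply, ih]
        congr 1
        exact A.leibniz s _ _ (f a) (hf a) (fun _ ↦ rfl) x
    exact this _
  rw [hsum, map_sum]
  have hx2 := (Filter.Eventually.self_of_nhds hx).2.2
  conv_rhs => rw [← b.sum_repr (secDeriv x₀ t x (A.anchor x (s x))), ← Finset.sum_add_distrib]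
  refine Finset.sum_congr rfl fun j _ ↦ ?_
  rw [map_add, map_smul, map_smul, hx2 j, fibCoord_fibSymm hb, hd j, (hfe j).self_of_nhds]
  rfl

/-- The structure functions of the bracket in the frame at `x₀`, as a bilinear map. -/
def structMap (x₀ x : M) : F →L[ℝ] F →L[ℝ] F :=
  ∑ i, ∑ j, (LinearMap.toContinuousLinearMap ((Module.finBasis ℝ F).coord i)).smulRight
    ((LinearMap.toContinuousLinearMap ((Module.finBasis ℝ F).coord j)).smulRight
      (fibCoord F E x₀ x (A.bracket (constSection EM E x₀ (Module.finBasis ℝ F i))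
        (constSection EM E x₀ (Module.finBasis ℝ F j)) x)))

theorem structMap_apply (x₀ x : M) (f g : F) : A.structMap x₀ x f g =
    ∑ i, ∑ j, (Module.finBasis ℝ F).repr f i • (Module.finBasis ℝ F).repr g j •
      fibCoord F E x₀ x (A.bracket (constSection EM E x₀ (Module.finBasis ℝ F i))
        (constSection EM E x₀ (Module.finBasis ℝ F j)) x) := by
  simp [structMap]

/-- Skewness is what removes `p(c(a, b))` when the fibre derivative of the Euler-Lagrange equation
is symmetrized. -/
theorem structMap_skew (x₀ x : M) (f g : F) : A.structMap x₀ x f g = - A.structMap x₀ x g f := by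
  rw [structMap_apply, structMap_apply, Finset.sum_comm, ← Finset.sum_neg_distrib]
  refine Finset.sum_congr rfl fun i _ ↦ ?_
  rw [← Finset.sum_neg_distrib]
  refine Finset.sum_congr rfl fun j _ ↦ ?_
  rw [A.bracket_skew, ContMDiffSection.coe_neg, Pi.neg_apply, map_neg, smul_neg, smul_neg,
    smul_comm]

theorem fibCoord_bracket (s t : Cₛ^∞⟮𝓘(ℝ, EM); F, E⟯) {x₀ x : M}
    (hx : x ∈ frameSet EM F E x₀) :
    fibCoord F E x₀ x (A.bracket s t x) =
      secDeriv x₀ t x (A.anchor x (s x)) - secDeriv x₀ s x (A.anchor x (t x)) +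
        A.structMap x₀ x (fibCoord F E x₀ x (s x)) (fibCoord F E x₀ x (t x)) := by
  rw [A.fibCoord_bracket_expand s t hx]
  set b := Module.finBasis ℝ F
  have hb := frameSet_subset_baseSet hx
  have hx2 := (Filter.Eventually.self_of_nhds hx).2.2
  -- The second argument is already expanded in the frame; skewness moves `s` into that slot so that
  -- the same expansion applies to it.
  have h1 : ∀ j, fibCoord F E x₀ x (A.bracket s (constSection EM E x₀ (b j)) x) =
      -(∑ i, b.repr (fibCoord F E x₀ x (s x)) i • fibCoord F E x₀ x
        (A.bracket (constSection EM E x₀ (b j)) (constSection EM E x₀ (b i)) x)) -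
      secDeriv x₀ s x (A.anchor x (constSection EM E x₀ (b j) x)) := by
    intro j
    rw [A.bracket_skew, ContMDiffSection.coe_neg, Pi.neg_apply, map_neg,
      A.fibCoord_bracket_expand _ _ hx, neg_add, sub_eq_add_neg]
  have h2 : secDeriv x₀ s x (A.anchor x (t x)) = ∑ j, b.repr (fibCoord F E x₀ x (t x)) j •
      secDeriv x₀ s x (A.anchor x (constSection EM E x₀ (b j) x)) := by
    -- The derivative of `s` along the anchor is linear in the value at `x`, so it distributes over
    -- the frame expansion of `t x`.
    let T : E x →ₗ[ℝ] F :=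
      { toFun := fun a ↦ secDeriv x₀ s x (A.anchor x a)
        map_add' := fun a a' ↦ by rw [map_add, secDeriv_add]
        map_smul' := fun c a ↦ by rw [map_smul, secDeriv_smul, RingHom.id_apply] }
    have ht : t x = ∑ j, b.repr (fibCoord F E x₀ x (t x)) j • constSection EM E x₀ (b j) x := by
      apply fibCoord_injective hb
      rw [map_sum]
      conv_lhs => rw [← b.sum_repr (fibCoord F E x₀ x (t x))]
      refine Finset.sum_congr rfl fun j _ ↦ ?_
      rw [map_smul, hx2 j, fibCoord_fibSymm hb]
    change T (t x) = ∑ j, b.repr (fibCoord F E x₀ x (t x)) j • T (constSection EM E x₀ (b j) x)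
    conv_lhs => rw [ht]
    rw [map_sum]
    exact Finset.sum_congr rfl fun j _ ↦ map_smul _ _ _
  have h3 : A.structMap x₀ x (fibCoord F E x₀ x (s x)) (fibCoord F E x₀ x (t x)) =
      -∑ j, b.repr (fibCoord F E x₀ x (t x)) j • ∑ i, b.repr (fibCoord F E x₀ x (s x)) i •
        fibCoord F E x₀ x
        (A.bracket (constSection EM E x₀ (b j)) (constSection EM E x₀ (b i)) x) := by
    rw [structMap_skew, structMap_apply]
    simp only [Finset.smul_sum]
    rfl
  rw [h2, h3]
  simp only [h1, smul_sub, smul_neg, Finset.sum_sub_distrib, Finset.sum_neg_distrib]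
  abel

end Frame

end LieAlgebroid

end

noncomputable section

namespace LieAlgebroid

open ChartField

set_option linter.unusedSectionVars false

/-! ### Sections of the prolongation in coordinates -/

section Prolongation

variable {EM : Type*} [NormedAddCommGroup EM] [NormedSpace ℝ EM] [FiniteDimensional ℝ EM]
  {M : Type*} [TopologicalSpace M] [T2Space M] [ChartedSpace EM M] [IsManifold 𝓘(ℝ, EM) ∞ M]
  {F : Type*} [NormedAddCommGroup F] [NormedSpace ℝ F] [FiniteDimensional ℝ F]
  {E : M → Type*} [TopologicalSpace (TotalSpace F E)]
  [∀ x, AddCommGroup (E x)] [∀ x, Module ℝ (E x)] [∀ x, TopologicalSpace (E x)]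
  [FiberBundle F E] [VectorBundle ℝ F E] [ContMDiffVectorBundle ∞ F E 𝓘(ℝ, EM)]
  (A : LieAlgebroid EM F E)

/-- The anchor over `x`, read in the chart and the trivialization at `x₀`. -/
def anchorMap (x₀ x : M) : F →L[ℝ] EM :=
  LinearMap.toContinuousLinearMap ((chartD 𝓘(ℝ, EM) x₀ x).toLinearMap ∘ₗ A.anchor x ∘ₗ
    fibSymm F E x₀ x)

theorem anchorMap_fibCoord {x₀ x : M} (hx : x ∈ (trivializationAt F E x₀).baseSet) (a : E x) :
    A.anchorMap x₀ x (fibCoord F E x₀ x a) = chartD 𝓘(ℝ, EM) x₀ x (A.anchor x a) := by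
  conv_rhs => rw [← fibSymm_fibCoord hx a]
  rfl

/-- The matrix of the anchor as a function on the range of the chart at `x₀`. -/
def anchorC (x₀ : M) (x : EM) : F →L[ℝ] EM := A.anchorMap x₀ ((baseChart EM x₀).symm x)

/-- The structure functions on the range of the chart at `x₀`. -/
def structC (x₀ : M) (x : EM) : F →L[ℝ] F →L[ℝ] F := A.structMap x₀ ((baseChart EM x₀).symm x)

/-- In finite dimensions it suffices to evaluate at fixed vectors, and the smooth anchor maps
frame-constant sections to smooth vector fields. -/
theorem contDiffOn_anchorC (x₀ : M) : ContDiffOn ℝ ∞ (A.anchorC x₀)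
    ((baseChart EM x₀).target ∩ (baseChart EM x₀).symm ⁻¹' (frameSet EM F E x₀)) := by
  rw [contDiffOn_clm_apply]
  intro f
  have h1 : ContMDiffOn 𝓘(ℝ, EM) (𝓘(ℝ, EM).prod 𝓘(ℝ, F)) ∞
      (fun y ↦ TotalSpace.mk' F y (fibSymm F E x₀ y f)) (frameSet EM F E x₀) := by
    rw [(trivializationAt F E x₀).contMDiffOn_section_iff (isOpen_frameSet x₀)
      fun _ ↦ frameSet_subset_baseSet]
    refine (contMDiffOn_const (c := f)).congr fun y hy ↦ ?_
    rw [fibCoord_eq (frameSet_subset_baseSet hy), fibCoord_fibSymm (frameSet_subset_baseSet hy)]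
  have h2 := A.anchor_smooth.comp_contMDiffOn h1
  exact (contMDiffOn_vectorField_iff (p₀ := x₀) (fun y ↦ A.anchor y (fibSymm F E x₀ y f))
    (isOpen_frameSet x₀) fun _ ↦ frameSet_subset_source).1 h2

theorem contDiffOn_structC (x₀ : M) : ContDiffOn ℝ ∞ (A.structC x₀)
    ((baseChart EM x₀).target ∩ (baseChart EM x₀).symm ⁻¹' (frameSet EM F E x₀)) := by
  rw [contDiffOn_clm_apply]
  intro f
  rw [contDiffOn_clm_apply]
  intro g
  simp only [structC, structMap_apply]
  refine ContDiffOn.sum fun i _ ↦ ContDiffOn.sum fun j _ ↦ contDiffOn_const.smul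
    (contDiffOn_const.smul ?_)
  refine (contMDiffOn_iff_chart (p₀ := x₀) (f := fun y ↦ fibCoord F E x₀ y
    (A.bracket (constSection EM E x₀ (Module.finBasis ℝ F i))
      (constSection EM E x₀ (Module.finBasis ℝ F j)) y))
    (isOpen_frameSet x₀) fun _ ↦ frameSet_subset_source).1 fun y hy ↦ ?_
  exact (contMDiffAt_fibCoord_section _ (frameSet_subset_baseSet hy)).contMDiffWithinAt

variable (EM) in
/-- The part of the total space over `frameSet`, on which the coordinates at `w₀` are used. -/
def frameDom (w₀ : TotalSpace F E) : Set (TotalSpace F E) := {w | w.proj ∈ frameSet EM F E w₀.proj}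

theorem isOpen_frameDom (w₀ : TotalSpace F E) : IsOpen (frameDom EM w₀) :=
  (isOpen_frameSet w₀.proj).preimage (FiberBundle.continuous_proj F E)

theorem mem_frameDom_self (w₀ : TotalSpace F E) : w₀ ∈ frameDom EM w₀ := mem_frameSet_self w₀.proj

theorem frameDom_subset (w₀ : TotalSpace F E) : frameDom EM w₀ ⊆ (totChart EM w₀).source :=
  fun _ hw ↦ mem_totChart_source.2 ⟨frameSet_subset_source hw, frameSet_subset_baseSet hw⟩

variable (EM) in
/-- The image of a subset of the total space in the chart at `w₀`. -/
def coordSet (w₀ : TotalSpace F E) (V : Set (TotalSpace F E)) : Set (EM × F) :=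
  (totChart EM w₀).target ∩ (totChart EM w₀).symm ⁻¹' V

variable {w₀ : TotalSpace F E} {V : Set (TotalSpace F E)} {q : EM × F}

theorem isOpen_coordSet (hV : IsOpen V) : IsOpen (coordSet EM w₀ V) :=
  (continuousOn_extChartAt_symm w₀).isOpen_inter_preimage (isOpen_target w₀) hV

theorem mem_coordSet {w : TotalSpace F E} (hw : w ∈ V) (hw' : w ∈ (totChart EM w₀).source) :
    totChart EM w₀ w ∈ coordSet EM w₀ V :=
  ⟨(totChart EM w₀).map_source hw', by rwa [mem_preimage, (totChart EM w₀).left_inv hw']⟩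

theorem mem_frameCoord (hV : V ⊆ frameDom EM w₀) (hq : q ∈ coordSet EM w₀ V) :
    q.1 ∈ (baseChart EM w₀.proj).target ∩
      (baseChart EM w₀.proj).symm ⁻¹' (frameSet EM F E w₀.proj) := by
  have h := hV hq.2
  rw [frameDom, mem_ofPred_eq, totChart_symm_proj hq.1] at h
  exact ⟨(mem_totChart_target.1 hq.1).1, h⟩

theorem contDiffOn_anchorC_fst (hV : V ⊆ frameDom EM w₀) :
    ContDiffOn ℝ ∞ (fun q : EM × F ↦ A.anchorC w₀.proj q.1) (coordSet EM w₀ V) :=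
  (A.contDiffOn_anchorC w₀.proj).comp contDiff_fst.contDiffOn fun _ hq ↦ mem_frameCoord hV hq

theorem contDiffOn_structC_fst (hV : V ⊆ frameDom EM w₀) :
    ContDiffOn ℝ ∞ (fun q : EM × F ↦ A.structC w₀.proj q.1) (coordSet EM w₀ V) :=
  (A.contDiffOn_structC w₀.proj).comp contDiff_fst.contDiffOn fun _ hq ↦ mem_frameCoord hV hq

/-- The coordinates of the first component of a field. -/
def fstC (w₀ : TotalSpace F E) (ρ : ProlField EM F E) (q : EM × F) : F :=
  fibCoord F E w₀.proj _ (ρ ((totChart EM w₀).symm q)).1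

/-- The coordinates of the second component of a field. -/
def sndC (w₀ : TotalSpace F E) (ρ : ProlField EM F E) (q : EM × F) : EM × F :=
  chartVec w₀ (fun w ↦ (ρ w).2) q

theorem mem_prolongation_iff (ρ : ProlField EM F E) (hq : q ∈ (totChart EM w₀).target) :
    ρ ((totChart EM w₀).symm q) ∈ A.prolongation ((totChart EM w₀).symm q) ↔
      (sndC w₀ ρ q).1 = A.anchorC w₀.proj q.1 (fstC w₀ ρ q) := by
  have hs := (totChart EM w₀).map_target hq
  have hs2 := mem_totChart_source.1 hs
  have h1 : A.anchorC w₀.proj q.1 (fstC w₀ ρ q) = chartD 𝓘(ℝ, EM) w₀.proj _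
      (A.anchor _ (ρ ((totChart EM w₀).symm q)).1) := by
    rw [anchorC, ← totChart_symm_proj hq, fstC, A.anchorMap_fibCoord hs2.2]
  have h2 := chartD_mfderiv_proj hs (ρ ((totChart EM w₀).symm q)).2
  rw [h1]
  change _ ↔ (totD w₀ _ (ρ ((totChart EM w₀).symm q)).2).1 = _
  rw [← h2, (chartD_injective hs2.1).eq_iff]
  exact eq_comm

theorem contMDiffOn_fst_iff (ρ : ProlField EM F E) (hVo : IsOpen V) (hV : V ⊆ frameDom EM w₀) :
    ContMDiffOn (𝓘(ℝ, EM).prod 𝓘(ℝ, F)) (𝓘(ℝ, EM).prod 𝓘(ℝ, F)) ∞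
      (fun w ↦ (⟨w.proj, (ρ w).1⟩ : TotalSpace F E)) V ↔
    ContDiffOn ℝ ∞ (fstC w₀ ρ) (coordSet EM w₀ V) := by
  have hm : MapsTo (fun w ↦ (⟨w.proj, (ρ w).1⟩ : TotalSpace F E)) V
      (trivializationAt F E w₀.proj).source := fun w hw ↦ by
    have hw' := frameSet_subset_baseSet (hV hw)
    rw [Bundle.Trivialization.mem_source]
    exact hw'
  rw [Bundle.Trivialization.contMDiffOn_iff hm]
  have h1 : ContMDiffOn (𝓘(ℝ, EM).prod 𝓘(ℝ, F)) 𝓘(ℝ, EM) ∞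
      (fun w : TotalSpace F E ↦ w.proj) V := contMDiffOn_proj E
  have h2 : ContMDiffOn (𝓘(ℝ, EM).prod 𝓘(ℝ, F)) 𝓘(ℝ, F) ∞
      (fun w : TotalSpace F E ↦ fibCoord F E w₀.proj _ (ρ w).1) V ↔
      ContDiffOn ℝ ∞ (fstC w₀ ρ) (coordSet EM w₀ V) :=
    contMDiffOn_iff_chart hVo (hV.trans (frameDom_subset w₀))
  rw [← h2]
  constructor
  · rintro ⟨-, h⟩
    exact h.congr fun w hw ↦ (fibCoord_eq (frameSet_subset_baseSet (hV hw)) _).symm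
  · intro h
    exact ⟨h1, h.congr fun w hw ↦ fibCoord_eq (frameSet_subset_baseSet (hV hw)) _⟩

/-- The free data of a section are `z` and the fibre part `v` of its tangent vector; the anchor
determines the rest. All later coordinate arguments pass through this dictionary. -/
theorem isSectionOn_iff (ρ : ProlField EM F E) (hVo : IsOpen V) (hV : V ⊆ frameDom EM w₀) :
    A.IsSectionOn V ρ ↔
      (∀ q ∈ coordSet EM w₀ V, (sndC w₀ ρ q).1 = A.anchorC w₀.proj q.1 (fstC w₀ ρ q)) ∧
      ContDiffOn ℝ ∞ (fstC w₀ ρ) (coordSet EM w₀ V) ∧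
      ContDiffOn ℝ ∞ (sndC w₀ ρ) (coordSet EM w₀ V) := by
  have h2 := contMDiffOn_vectorField_iff (p₀ := w₀) (fun w ↦ (ρ w).2) hVo
    (hV.trans (frameDom_subset w₀))
  constructor
  · rintro ⟨hm, hf, hs⟩
    exact ⟨fun q hq ↦ (A.mem_prolongation_iff ρ hq.1).1 (hm _ hq.2),
      (contMDiffOn_fst_iff ρ hVo hV).1 hf, h2.1 hs⟩
  · rintro ⟨hm, hf, hs⟩
    refine ⟨fun w hw ↦ ?_, (contMDiffOn_fst_iff ρ hVo hV).2 hf, h2.2 hs⟩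
    have hw' := frameDom_subset w₀ (hV hw)
    have h := (A.mem_prolongation_iff ρ ((totChart EM w₀).map_source hw')).2
      (hm _ (mem_coordSet hw hw'))
    rwa [(totChart EM w₀).left_inv hw'] at h

/-- Two elements of `E_x × T_w E` with the same coordinates are equal. -/
theorem ext_coord {ρ ρ' : ProlField EM F E} (hq : q ∈ (totChart EM w₀).target)
    (h1 : fstC w₀ ρ q = fstC w₀ ρ' q) (h2 : sndC w₀ ρ q = sndC w₀ ρ' q) :
    ρ ((totChart EM w₀).symm q) = ρ' ((totChart EM w₀).symm q) :=
  Prod.ext (fibCoord_injective (symm_proj_mem_baseSet hq) h1)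
    (chartD_injective ((totChart EM w₀).map_target hq) h2)

variable (w₀) in
/-- The field with given coordinates. -/
def mkField (z : EM × F → F) (X : EM × F → EM × F) : ProlField EM F E := fun w ↦
  (fibSymm F E w₀.proj w.proj (z (totChart EM w₀ w)),
    chartDsymm (𝓘(ℝ, EM).prod 𝓘(ℝ, F)) w₀ (totChart EM w₀ w) (X (totChart EM w₀ w)))

theorem fstC_mkField (z : EM × F → F) (X : EM × F → EM × F) (hq : q ∈ (totChart EM w₀).target) :
    fstC w₀ (mkField w₀ z X) q = z q := by
  rw [fstC, mkField, fibCoord_fibSymm (symm_proj_mem_baseSet hq), (totChart EM w₀).right_inv hq]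

theorem sndC_mkField (z : EM × F → F) (X : EM × F → EM × F) (hq : q ∈ (totChart EM w₀).target) :
    sndC w₀ (mkField w₀ z X) q = X q := by
  have h := (totChart EM w₀).right_inv hq
  let D : EM × F → EM × F →L[ℝ] EM × F := fun q' ↦ chartDsymm (𝓘(ℝ, EM).prod 𝓘(ℝ, F)) w₀ q'
  let D' : EM × F →L[ℝ] EM × F := totD w₀ ((totChart EM w₀).symm q)
  change D' (D (totChart EM w₀ ((totChart EM w₀).symm q))
    (X (totChart EM w₀ ((totChart EM w₀).symm q)))) = _
  rw [h]
  exact chartD_chartDsymm hq (X q)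

/-- The source of local sections: test sections with constant `(z, v)`, and the local solution of
the Euler-Lagrange equation. -/
theorem isSectionOn_mkField {z v : EM × F → F} (hVo : IsOpen V) (hV : V ⊆ frameDom EM w₀)
    (hz : ContDiffOn ℝ ∞ z (coordSet EM w₀ V)) (hv : ContDiffOn ℝ ∞ v (coordSet EM w₀ V)) :
    A.IsSectionOn V (mkField w₀ z fun q ↦ (A.anchorC w₀.proj q.1 (z q), v q)) := by
  rw [A.isSectionOn_iff _ hVo hV]
  refine ⟨fun q hq ↦ ?_, hz.congr fun q hq ↦ fstC_mkField _ _ hq.1, ?_⟩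
  · rw [sndC_mkField _ _ hq.1, fstC_mkField _ _ hq.1]
  · refine ContDiffOn.congr ?_ fun q hq ↦ sndC_mkField _ _ hq.1
    exact ((A.contDiffOn_anchorC_fst hV).clm_apply hz).prodMk hv

theorem fstC_vertEndo (ρ : ProlField EM F E) : fstC w₀ (vertEndo EM ρ) q = 0 := by
  simp [fstC, vertEndo]

theorem sndC_vertEndo (ρ : ProlField EM F E) (hq : q ∈ (totChart EM w₀).target) :
    sndC w₀ (vertEndo EM ρ) q = (0, fstC w₀ ρ q) :=
  totD_vlift ((totChart EM w₀).map_target hq) _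

theorem fstC_euler : fstC w₀ (euler EM F E) q = 0 := by
  simp [fstC, euler]

theorem sndC_euler (hq : q ∈ (totChart EM w₀).target) :
    sndC w₀ (euler EM F E) q = (0, q.2) :=
  (totD_vlift ((totChart EM w₀).map_target hq) _).trans (by rw [fibCoord_totChart_symm hq])

theorem dirDeriv_eq {f : TotalSpace F E → ℝ} (hq : q ∈ (totChart EM w₀).target)
    (hf : DifferentiableAt ℝ (f ∘ (totChart EM w₀).symm) q)
    (X : TangentSpace (𝓘(ℝ, EM).prod 𝓘(ℝ, F)) ((totChart EM w₀).symm q)) :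
    dirDeriv EM f ((totChart EM w₀).symm q) X =
      fderiv ℝ (f ∘ (totChart EM w₀).symm) q (totD w₀ _ X) :=
  mfderiv_eq_fderiv_chart hq ((mdifferentiableAt_iff_chart hq).2 hf) X

theorem sndC_prolBracket {ρ₁ ρ₂ : ProlField EM F E} (hq : q ∈ (totChart EM w₀).target)
    (h1 : DifferentiableAt ℝ (sndC w₀ ρ₁) q) (h2 : DifferentiableAt ℝ (sndC w₀ ρ₂) q) :
    sndC w₀ (A.prolBracket ρ₁ ρ₂) q =
      fderiv ℝ (sndC w₀ ρ₂) q (sndC w₀ ρ₁ q) - fderiv ℝ (sndC w₀ ρ₁) q (sndC w₀ ρ₂ q) :=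
  chartVec_mlieBracket hq h1 h2

end Prolongation

end LieAlgebroid

end

noncomputable section

namespace LieAlgebroid

open ChartField

set_option linter.unusedSectionVars false

/-! ### The first component of the bracket in an arbitrary trivialization -/

section Bracket

variable {EM : Type*} [NormedAddCommGroup EM] [NormedSpace ℝ EM] [FiniteDimensional ℝ EM]
  {M : Type*} [TopologicalSpace M] [T2Space M] [ChartedSpace EM M] [IsManifold 𝓘(ℝ, EM) ∞ M]
  {F : Type*} [NormedAddCommGroup F] [NormedSpace ℝ F] [FiniteDimensional ℝ F]
  {E : M → Type*} [TopologicalSpace (TotalSpace F E)]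
  [∀ x, AddCommGroup (E x)] [∀ x, Module ℝ (E x)] [∀ x, TopologicalSpace (E x)]
  [FiberBundle F E] [VectorBundle ℝ F E] [ContMDiffVectorBundle ∞ F E 𝓘(ℝ, EM)]
  (A : LieAlgebroid EM F E)

variable (F E) in
/-- The transition map from the trivialization at `x₀` to the one at `x`. -/
def transMap (x₀ x y : M) : F →L[ℝ] F :=
  ((trivializationAt F E x₀).coordChangeL ℝ (trivializationAt F E x) y : F →L[ℝ] F)

theorem transMap_fibCoord {x₀ x y : M} (hy₀ : y ∈ (trivializationAt F E x₀).baseSet)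
    (hy : y ∈ (trivializationAt F E x).baseSet) (a : E y) :
    transMap F E x₀ x y (fibCoord F E x₀ y a) = fibCoord F E x y a := by
  rw [transMap, ContinuousLinearEquiv.coe_coe,
    Bundle.Trivialization.coordChangeL_apply _ _ ⟨hy₀, hy⟩, fibSymm_eq hy₀, fibSymm_fibCoord hy₀,
    fibCoord_eq hy]

variable (EM F E) in
/-- The transition map as a function on the range of the chart at `x₀`. -/
def transC (x₀ x : M) (u : EM) : F →L[ℝ] F := transMap F E x₀ x ((baseChart EM x₀).symm u)

theorem differentiableAt_transC {x₀ x : M} (hx : x ∈ (trivializationAt F E x₀).baseSet)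
    (hx' : x ∈ (baseChart EM x₀).source) :
    DifferentiableAt ℝ (transC EM F E x₀ x) (baseChart EM x₀ x) := by
  have h : ContMDiffAt 𝓘(ℝ, EM) 𝓘(ℝ, F →L[ℝ] F) ∞ (transMap F E x₀ x) x :=
    contMDiffAt_coordChangeL hx (mem_baseSet_trivializationAt F E x)
  exact differentiableAt_chart_of_mem hx' (h.mdifferentiableAt (by simp))

/-- The derivative of the coordinates of a section which is constant in the trivialization
at `x`. -/
theorem transMap_secDeriv_constSection {x₀ x : M} (hx : x ∈ (trivializationAt F E x₀).baseSet)
    (hx' : x ∈ (baseChart EM x₀).source) (f : F) (v : TangentSpace 𝓘(ℝ, EM) x) :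
    transMap F E x₀ x x (secDeriv x₀ (constSection EM E x f) x v) =
      - fderiv ℝ (transC EM F E x₀ x) (baseChart EM x₀ x) (chartD 𝓘(ℝ, EM) x₀ x v)
        (fibCoord F E x₀ x (constSection EM E x f x)) := by
  set s := constSection EM E x f
  have hs := (contMDiffAt_fibCoord_section s hx).mdifferentiableAt (n := ∞) (by simp)
  have h1 : secDeriv x₀ s x v = _ := mfderiv_eq_fderiv_chart_of_mem hx' hs v
  have hd : DifferentiableAt ℝ ((fun y ↦ fibCoord F E x₀ y (s y)) ∘ (baseChart EM x₀).symm)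
      (baseChart EM x₀ x) := differentiableAt_chart_of_mem hx' hs
  -- Transition map times coordinates is constant near `x`. Differentiating this product expresses
  -- the derivative of the coordinates through that of the transition map.
  have hc : ∀ᶠ y in 𝓝 x, transMap F E x₀ x y (fibCoord F E x₀ y (s y)) = f := by
    filter_upwards [Classical.choose_spec (exists_constSection EM E x f),
      (trivializationAt F E x).open_baseSet.mem_nhds (mem_baseSet_trivializationAt F E x),
      (trivializationAt F E x₀).open_baseSet.mem_nhds hx] with y h1 h2 h3
    rw [transMap_fibCoord h3 h2]
    change fibCoord F E x y (Classical.choose (exists_constSection EM E x f) y) = f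
    rw [h1, fibSymm_eq h2, fibCoord_fibSymm h2]
  have hc2 : (fun u ↦ transC EM F E x₀ x u
      (((fun y ↦ fibCoord F E x₀ y (s y)) ∘ (baseChart EM x₀).symm) u)) =ᶠ[𝓝 (baseChart EM x₀ x)]
      fun _ ↦ f := by
    have ht : Filter.Tendsto (baseChart EM x₀).symm (𝓝 (baseChart EM x₀ x)) (𝓝 x) := by
      have := continuousAt_extChartAt_symm' (I := 𝓘(ℝ, EM)) hx'
      unfold ContinuousAt at this
      rwa [(baseChart EM x₀).left_inv hx'] at this
    exact ht.eventually hc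
  have h3 := (differentiableAt_transC hx hx').hasFDerivAt.clm_apply hd.hasFDerivAt
  have h4 := h3.fderiv
  rw [hc2.fderiv_eq, fderiv_fun_const] at h4
  have h5 := congrArg (fun T : EM →L[ℝ] F ↦ T (chartD 𝓘(ℝ, EM) x₀ x v)) h4
  simp only [Pi.zero_apply, zero_apply, add_apply,
    ContinuousLinearMap.comp_apply, ContinuousLinearMap.flip_apply, Function.comp_apply] at h5
  rw [(baseChart EM x₀).left_inv hx', transC, (baseChart EM x₀).left_inv hx'] at h5
  rw [h1]
  exact eq_neg_of_add_eq_zero_left h5.symm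

variable {w₀ : TotalSpace F E} {q : EM × F}

/-- The product rule for a change of trivialization: besides the transformed derivative, a term with
the derivative of the transition map appears. -/
theorem fstCoordDeriv_eq {ρ : ProlField EM F E} (hq : q ∈ (totChart EM w₀).target)
    (hρ : DifferentiableAt ℝ (fstC w₀ ρ) q)
    (X : TangentSpace (𝓘(ℝ, EM).prod 𝓘(ℝ, F)) ((totChart EM w₀).symm q)) :
    fstCoordDeriv ((totChart EM w₀).symm q).proj ρ ((totChart EM w₀).symm q) X =
      fderiv ℝ (transC EM F E w₀.proj ((totChart EM w₀).symm q).proj) q.1 (totD w₀ _ X).1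
        (fstC w₀ ρ q) +
      transMap F E w₀.proj ((totChart EM w₀).symm q).proj ((totChart EM w₀).symm q).proj
        (fderiv ℝ (fstC w₀ ρ) q (totD w₀ _ X)) := by
  have hs := mem_totChart_source.1 ((totChart EM w₀).map_target hq)
  have hb := baseChart_totChart_symm hq
  revert X
  set w := (totChart EM w₀).symm q with hw
  intro X
  have heq : (fstCoord w.proj ρ) ∘ (totChart EM w₀).symm =ᶠ[𝓝 q]
      fun q' : EM × F ↦ transC EM F E w₀.proj w.proj q'.1 (fstC w₀ ρ q') := by
    have hn : coordSet EM w₀ {w' | w'.proj ∈ (trivializationAt F E w.proj).baseSet} ∈ 𝓝 q := by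
      refine (isOpen_coordSet ?_).mem_nhds ⟨hq, ?_⟩
      · exact (trivializationAt F E w.proj).open_baseSet.preimage (FiberBundle.continuous_proj F E)
      · exact mem_baseSet_trivializationAt F E w.proj
    filter_upwards [hn] with q' hq'
    rw [transC, ← totChart_symm_proj hq'.1, fstC,
      transMap_fibCoord (symm_proj_mem_baseSet hq'.1) hq'.2]
    exact fibCoord_eq hq'.2 _
  have hT : DifferentiableAt ℝ (transC EM F E w₀.proj w.proj) q.1 := by
    have := differentiableAt_transC hs.2 hs.1
    rwa [hb] at this
  have hT2 : HasFDerivAt (fun q' : EM × F ↦ transC EM F E w₀.proj w.proj q'.1)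
      ((fderiv ℝ (transC EM F E w₀.proj w.proj) q.1).comp (ContinuousLinearMap.fst ℝ EM F)) q :=
    hT.hasFDerivAt.comp q hasFDerivAt_fst
  have h3 := (hT2.clm_apply hρ.hasFDerivAt).congr_of_eventuallyEq heq
  have h4 : fstCoordDeriv w.proj ρ w X = _ := mfderiv_eq_fderiv_chart hq
    ((mdifferentiableAt_iff_chart hq).2 h3.differentiableAt) X
  rw [h4, h3.fderiv]
  have htr : transC EM F E w₀.proj w.proj q.1 = transMap F E w₀.proj w.proj w.proj := by
    rw [transC, ← totChart_symm_proj hq]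
  rw [← htr, add_comm]
  rfl

/-- The derivatives of the transition map coming from `fstCoordDeriv` cancel those coming from
sections constant in the trivialization at the point. Having one trivialization for a whole
neighbourhood is what permits brackets to be differentiated and iterated. -/
theorem fstC_prolBracket {ρ₁ ρ₂ : ProlField EM F E} (hq : q ∈ (totChart EM w₀).target)
    (hq' : (totChart EM w₀).symm q ∈ frameDom EM w₀)
    (h1 : DifferentiableAt ℝ (fstC w₀ ρ₁) q) (h2 : DifferentiableAt ℝ (fstC w₀ ρ₂) q)
    (hm1 : (sndC w₀ ρ₁ q).1 = A.anchorC w₀.proj q.1 (fstC w₀ ρ₁ q))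
    (hm2 : (sndC w₀ ρ₂ q).1 = A.anchorC w₀.proj q.1 (fstC w₀ ρ₂ q)) :
    fstC w₀ (A.prolBracket ρ₁ ρ₂) q =
      fderiv ℝ (fstC w₀ ρ₂) q (sndC w₀ ρ₁ q) - fderiv ℝ (fstC w₀ ρ₁) q (sndC w₀ ρ₂ q) +
        A.structC w₀.proj q.1 (fstC w₀ ρ₁ q) (fstC w₀ ρ₂ q) := by
  have hs := mem_totChart_source.1 ((totChart EM w₀).map_target hq)
  have hb := baseChart_totChart_symm hq
  have hf1 := fstCoordDeriv_eq hq h1 (ρ₂ ((totChart EM w₀).symm q)).2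
  have hf2 := fstCoordDeriv_eq hq h2 (ρ₁ ((totChart EM w₀).symm q)).2
  change _ = fderiv ℝ (transC EM F E w₀.proj ((totChart EM w₀).symm q).proj) q.1 (sndC w₀ ρ₂ q).1
    (fstC w₀ ρ₁ q) + transMap F E _ _ _ (fderiv ℝ (fstC w₀ ρ₁) q (sndC w₀ ρ₂ q)) at hf1
  change _ = fderiv ℝ (transC EM F E w₀.proj ((totChart EM w₀).symm q).proj) q.1 (sndC w₀ ρ₁ q).1
    (fstC w₀ ρ₂ q) + transMap F E _ _ _ (fderiv ℝ (fstC w₀ ρ₂) q (sndC w₀ ρ₁ q)) at hf2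
  have hstr : A.structC w₀.proj q.1 =
      A.structMap w₀.proj ((totChart EM w₀).symm q).proj := by
    rw [structC, totChart_symm_proj hq]
  have hanc : A.anchorC w₀.proj q.1 = A.anchorMap w₀.proj ((totChart EM w₀).symm q).proj := by
    rw [anchorC, totChart_symm_proj hq]
  rw [hanc] at hm1 hm2
  rw [hstr]
  have hself := mem_baseSet_trivializationAt F E ((totChart EM w₀).symm q).proj
  have hinj : Function.Injective (transMap F E w₀.proj ((totChart EM w₀).symm q).proj
      ((totChart EM w₀).symm q).proj) := ContinuousLinearEquiv.injective _
  have hcs : ∀ ρ : ProlField EM F E, constSection EM E ((totChart EM w₀).symm q).proj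
      (fstCoord ((totChart EM w₀).symm q).proj ρ ((totChart EM w₀).symm q))
      ((totChart EM w₀).symm q).proj = (ρ ((totChart EM w₀).symm q)).1 := by
    intro ρ
    have := (Classical.choose_spec (exists_constSection EM E ((totChart EM w₀).symm q).proj
      (fstCoord ((totChart EM w₀).symm q).proj ρ ((totChart EM w₀).symm q)))).self_of_nhds
    refine this.trans ?_
    rw [fstCoord, fibCoord_eq hself, fibSymm_eq hself, fibSymm_fibCoord hself]
  have hbr := A.fibCoord_bracket (x₀ := w₀.proj) (x := ((totChart EM w₀).symm q).proj)
    (constSection EM E ((totChart EM w₀).symm q).proj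
      (fstCoord ((totChart EM w₀).symm q).proj ρ₁ ((totChart EM w₀).symm q)))
    (constSection EM E ((totChart EM w₀).symm q).proj
      (fstCoord ((totChart EM w₀).symm q).proj ρ₂ ((totChart EM w₀).symm q))) hq'
  have hk1 := transMap_secDeriv_constSection hs.2 hs.1
    (fstCoord ((totChart EM w₀).symm q).proj ρ₁ ((totChart EM w₀).symm q))
    (A.anchor _ (ρ₂ ((totChart EM w₀).symm q)).1)
  have hk2 := transMap_secDeriv_constSection hs.2 hs.1
    (fstCoord ((totChart EM w₀).symm q).proj ρ₂ ((totChart EM w₀).symm q))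
    (A.anchor _ (ρ₁ ((totChart EM w₀).symm q)).1)
  rw [hcs, ← A.anchorMap_fibCoord hs.2, hb] at hk1 hk2
  rw [hcs, hcs] at hbr
  change _ = -fderiv ℝ (transC EM F E w₀.proj ((totChart EM w₀).symm q).proj) q.1
    (A.anchorMap _ _ (fstC w₀ ρ₂ q)) (fstC w₀ ρ₁ q) at hk1
  change _ = -fderiv ℝ (transC EM F E w₀.proj ((totChart EM w₀).symm q).proj) q.1
    (A.anchorMap _ _ (fstC w₀ ρ₁ q)) (fstC w₀ ρ₂ q) at hk2
  change _ = _ - _ + A.structMap _ _ (fstC w₀ ρ₁ q) (fstC w₀ ρ₂ q) at hbr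
  -- The prolongation condition replaces the anchor of the first component by the base part of the
  -- tangent vector, so the two families of transition terms match.
  rw [← hm2] at hk1
  rw [← hm1] at hk2
  have hL : fstC w₀ (A.prolBracket ρ₁ ρ₂) q =
      fibCoord F E w₀.proj ((totChart EM w₀).symm q).proj
        (fibSymm F E ((totChart EM w₀).symm q).proj ((totChart EM w₀).symm q).proj
        (fstCoordDeriv ((totChart EM w₀).symm q).proj ρ₂ ((totChart EM w₀).symm q)
          (ρ₁ ((totChart EM w₀).symm q)).2 -
        fstCoordDeriv ((totChart EM w₀).symm q).proj ρ₁ ((totChart EM w₀).symm q)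
          (ρ₂ ((totChart EM w₀).symm q)).2)) +
      fibCoord F E w₀.proj ((totChart EM w₀).symm q).proj (A.bracket
        (constSection EM E ((totChart EM w₀).symm q).proj
          (fstCoord ((totChart EM w₀).symm q).proj ρ₁ ((totChart EM w₀).symm q)))
        (constSection EM E ((totChart EM w₀).symm q).proj
          (fstCoord ((totChart EM w₀).symm q).proj ρ₂ ((totChart EM w₀).symm q)))
        ((totChart EM w₀).symm q).proj) := by
    rw [fstC, prolBracket, map_add, fibSymm_eq hself]
  rw [hL, hbr]
  -- The two sides are compared in the trivialization centred at the point itself, where the bracket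
  -- was defined.
  apply hinj
  rw [map_add, transMap_fibCoord hs.2 hself, fibCoord_fibSymm hself, hf1, hf2]
  simp only [map_add, map_sub]
  rw [hk1, hk2]
  abel

end Bracket

end LieAlgebroid

end

noncomputable section

namespace LieAlgebroid

set_option linter.unusedSectionVars false

/-! ### Calculus of a Lagrangian on a product of vector spaces -/

section Calculus

variable {X F : Type*} [NormedAddCommGroup X] [NormedSpace ℝ X]
  [NormedAddCommGroup F] [NormedSpace ℝ F]

/-- The fibre derivative `∂ℓ/∂y`. -/
def momentum (ℓ : X × F → ℝ) (q : X × F) : F →L[ℝ] ℝ :=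
  (fderiv ℝ ℓ q).comp (ContinuousLinearMap.inr ℝ X F)

variable {ℓ : X × F → ℝ} {Ω : Set (X × F)} {q : X × F}

theorem momentum_apply (f : F) : momentum ℓ q f = fderiv ℝ ℓ q (0, f) := rfl

theorem contDiffOn_fderiv_top {G G' : Type*} [NormedAddCommGroup G] [NormedSpace ℝ G]
    [NormedAddCommGroup G'] [NormedSpace ℝ G'] {f : G → G'} {s : Set G}
    (hf : ContDiffOn ℝ ∞ f s) (hs : IsOpen s) : ContDiffOn ℝ ∞ (fderiv ℝ f) s :=
  hf.fderiv_of_isOpen hs (by simp)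

theorem differentiableAt_of_contDiffOn {G G' : Type*} [NormedAddCommGroup G] [NormedSpace ℝ G]
    [NormedAddCommGroup G'] [NormedSpace ℝ G'] {f : G → G'} {s : Set G}
    (hf : ContDiffOn ℝ ∞ f s) (hs : IsOpen s) {x : G} (hx : x ∈ s) : DifferentiableAt ℝ f x :=
  (hf.contDiffAt (hs.mem_nhds hx)).differentiableAt (by simp)

theorem hasDerivAt_line {G : Type*} [NormedAddCommGroup G] [NormedSpace ℝ G] (q v : G) :
    HasDerivAt (fun t : ℝ ↦ q + t • v) v 0 := by
  have h := ((hasDerivAt_id (0 : ℝ)).smul_const v).const_add q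
  rw [one_smul] at h
  exact h

theorem hasDerivAt_comp_line {G W : Type*} [NormedAddCommGroup G]
    [NormedSpace ℝ G] [NormedAddCommGroup W] [NormedSpace ℝ W] {h : G → W} {q : G}
    (hh : DifferentiableAt ℝ h q) (v : G) :
    HasDerivAt (fun t : ℝ ↦ h (q + t • v)) (fderiv ℝ h q v) 0 := by
  have hh' : HasFDerivAt h (fderiv ℝ h q) (q + (0 : ℝ) • v) := by
    rw [zero_smul, add_zero]; exact hh.hasFDerivAt
  exact hh'.comp_hasDerivAt 0 (hasDerivAt_line q v)

theorem contDiffOn_momentum (hℓ : ContDiffOn ℝ ∞ ℓ Ω) (hΩ : IsOpen Ω) :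
    ContDiffOn ℝ ∞ (momentum ℓ) Ω :=
  (contDiffOn_fderiv_top hℓ hΩ).clm_comp contDiffOn_const

theorem fderiv_momentum (hℓ : ContDiffOn ℝ ∞ ℓ Ω) (hΩ : IsOpen Ω) (hq : q ∈ Ω) (v : X × F) (f : F) :
    fderiv ℝ (momentum ℓ) q v f = fderiv ℝ (fderiv ℝ ℓ) q v (0, f) := by
  have h := (differentiableAt_of_contDiffOn (contDiffOn_fderiv_top hℓ hΩ) hΩ hq).hasFDerivAt
  have h2 := h.clm_comp (hasFDerivAt_const (ContinuousLinearMap.inr ℝ X F) q)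
  have h3 : fderiv ℝ (momentum ℓ) q = _ := h2.fderiv
  rw [h3]
  simp

theorem fderiv_fderiv_symm {G : Type*} [NormedAddCommGroup G] [NormedSpace ℝ G] {ℓ : X × F → G}
    (hℓ : ContDiffOn ℝ ∞ ℓ Ω) (hΩ : IsOpen Ω) (hq : q ∈ Ω) (v w : X × F) :
    fderiv ℝ (fderiv ℝ ℓ) q v w = fderiv ℝ (fderiv ℝ ℓ) q w v :=
  ((hℓ.contDiffAt (hΩ.mem_nhds hq)).isSymmSndFDerivAt (by
    rw [minSmoothness_of_isRCLikeNormedField]; exact WithTop.coe_le_coe.2 le_top)) v w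

theorem fderiv_momentum_symm (hℓ : ContDiffOn ℝ ∞ ℓ Ω) (hΩ : IsOpen Ω) (hq : q ∈ Ω) (a b : F) :
    fderiv ℝ (momentum ℓ) q (0, a) b = fderiv ℝ (momentum ℓ) q (0, b) a := by
  rw [fderiv_momentum hℓ hΩ hq, fderiv_momentum hℓ hΩ hq, fderiv_fderiv_symm hℓ hΩ hq]

/-- The fibre Hessian is symmetric at every point of an open set, hence so is its derivative in any
direction. -/
theorem fderiv_fderiv_momentum_symm (hℓ : ContDiffOn ℝ ∞ ℓ Ω) (hΩ : IsOpen Ω) (hq : q ∈ Ω)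
    (v : X × F) (a b : F) :
    fderiv ℝ (fderiv ℝ (momentum ℓ)) q v (0, a) b =
      fderiv ℝ (fderiv ℝ (momentum ℓ)) q v (0, b) a := by
  have hd := (differentiableAt_of_contDiffOn
    (contDiffOn_fderiv_top (contDiffOn_momentum hℓ hΩ) hΩ) hΩ hq).hasFDerivAt
  have key : ∀ a b : F, HasFDerivAt (fun q' ↦ fderiv ℝ (momentum ℓ) q' (0, a) b)
      (((fderiv ℝ (fderiv ℝ (momentum ℓ)) q).flip (0, a)).flip b) q := fun a b ↦ by
    have h1 := hd.clm_apply (hasFDerivAt_const ((0, a) : X × F) q)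
    have h2 := h1.clm_apply (hasFDerivAt_const b q)
    refine h2.congr_fderiv ?_
    ext <;> simp
  have he : (fun q' ↦ fderiv ℝ (momentum ℓ) q' (0, a) b) =ᶠ[𝓝 q]
      fun q' ↦ fderiv ℝ (momentum ℓ) q' (0, b) a := by
    filter_upwards [hΩ.mem_nhds hq] with q' hq' using fderiv_momentum_symm hℓ hΩ hq' a b
  have h := ((key a b).congr_of_eventuallyEq he.symm).unique (key b a)
  exact congrArg (fun T : X × F →L[ℝ] ℝ ↦ T v) h

/-- The Euler-Lagrange equation for the fibre component `s` of a semispray. -/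
def EulerLagrangeAt (σ : X → F →L[ℝ] X) (c : X → F →L[ℝ] F →L[ℝ] F) (ℓ : X × F → ℝ)
    (s : X × F → F) (q : X × F) : Prop :=
  ∀ f : F, fderiv ℝ (momentum ℓ) q (σ q.1 q.2, s q) f - momentum ℓ q (c q.1 q.2 f) =
    fderiv ℝ ℓ q (σ q.1 f, 0)

/-- The derivative of the Euler-Lagrange equation along the fibre. -/
theorem EulerLagrangeAt.fibre_deriv {σ : X → F →L[ℝ] X} {c : X → F →L[ℝ] F →L[ℝ] F}
    {s : X × F → F} (hℓ : ContDiffOn ℝ ∞ ℓ Ω) (hΩ : IsOpen Ω)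
    (hs : DifferentiableAt ℝ s q) (hEL : ∀ q ∈ Ω, EulerLagrangeAt σ c ℓ s q) (hq : q ∈ Ω)
    (a b : F) :
    fderiv ℝ (fderiv ℝ (momentum ℓ)) q (σ q.1 q.2, s q) (0, a) b +
      fderiv ℝ (momentum ℓ) q (σ q.1 a, 0) b +
      fderiv ℝ (momentum ℓ) q (0, fderiv ℝ s q (0, a)) b -
      (fderiv ℝ (momentum ℓ) q (0, a) (c q.1 q.2 b) + momentum ℓ q (c q.1 a b)) =
    fderiv ℝ (momentum ℓ) q (σ q.1 b, 0) a := by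
  have hp := contDiffOn_momentum hℓ hΩ
  -- Along this vertical line `x` is constant, so `σ` and `c` are never differentiated in `x`; they
  -- enter only through their linearity in `y`.
  let γ : ℝ → X × F := fun t ↦ q + t • ((0, a) : X × F)
  have hγ0 : γ 0 = q := by simp [γ]
  have hγ : HasDerivAt γ (0, a) 0 := hasDerivAt_line q (0, a)
  have hγ1 : ∀ t, (γ t).1 = q.1 := fun t ↦ by simp [γ]
  have hγ2 : ∀ t, (γ t).2 = q.2 + t • a := fun t ↦ by simp [γ]
  have hy : HasDerivAt (fun t ↦ (γ t).2) a 0 := by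
    simp only [hγ2]
    exact hasDerivAt_line q.2 a
  have h1 : HasDerivAt (fun t ↦ fderiv ℝ (momentum ℓ) (γ t) (σ q.1 (γ t).2, s (γ t)) b)
      (fderiv ℝ (fderiv ℝ (momentum ℓ)) q (0, a) (σ q.1 q.2, s q) b +
        fderiv ℝ (momentum ℓ) q (σ q.1 a, fderiv ℝ s q (0, a)) b) 0 := by
    have hA := hasDerivAt_comp_line (v := (0, a)) (
      differentiableAt_of_contDiffOn (contDiffOn_fderiv_top hp hΩ) hΩ hq)
    have hB : HasDerivAt (fun t ↦ (σ q.1 (γ t).2, s (γ t))) (σ q.1 a, fderiv ℝ s q (0, a)) 0 :=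
      ((σ q.1).hasFDerivAt.comp_hasDerivAt 0 hy).prodMk (hasDerivAt_comp_line hs (0, a))
    have hC := (hA.clm_apply hB).clm_apply (hasDerivAt_const (0 : ℝ) b)
    simp only [hγ0, map_zero, add_zero, add_apply, zero_smul] at hC
    exact hC
  have h2 : HasDerivAt (fun t ↦ momentum ℓ (γ t) (c q.1 (γ t).2 b))
      (fderiv ℝ (momentum ℓ) q (0, a) (c q.1 q.2 b) + momentum ℓ q (c q.1 a b)) 0 := by
    have hA := hasDerivAt_comp_line (v := (0, a)) (
      differentiableAt_of_contDiffOn hp hΩ hq)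
    have hB : HasDerivAt (fun t ↦ c q.1 (γ t).2 b) (c q.1 a b) 0 :=
      ((c q.1).flip b).hasFDerivAt.comp_hasDerivAt 0 hy
    have hC := hA.clm_apply hB
    simp only [hγ0, zero_smul, add_zero] at hC
    exact hC
  have h3 : HasDerivAt (fun t ↦ fderiv ℝ ℓ (γ t) (σ q.1 b, 0))
      (fderiv ℝ (fderiv ℝ ℓ) q (0, a) (σ q.1 b, 0)) 0 := by
    have hA := hasDerivAt_comp_line (v := (0, a)) (
      differentiableAt_of_contDiffOn (contDiffOn_fderiv_top hℓ hΩ) hΩ hq)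
    have hC := hA.clm_apply (hasDerivAt_const (0 : ℝ) ((σ q.1 b, 0) : X × F))
    simp only [map_zero, add_zero] at hC
    exact hC
  have he : (fun t ↦ fderiv ℝ (momentum ℓ) (γ t) (σ q.1 (γ t).2, s (γ t)) b -
      momentum ℓ (γ t) (c q.1 (γ t).2 b)) =ᶠ[𝓝 0] fun t ↦ fderiv ℝ ℓ (γ t) (σ q.1 b, 0) := by
    have hn : ∀ᶠ t in 𝓝 (0 : ℝ), γ t ∈ Ω :=
      hγ.continuousAt.eventually (by rw [hγ0]; exact hΩ.mem_nhds hq)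
    filter_upwards [hn] with t ht
    have := hEL _ ht b
    rwa [hγ1 t] at this
  have h4 := ((h1.sub h2).congr_of_eventuallyEq he.symm).unique h3
  -- Equality of mixed partials turns the fibre derivative of `∂ℓ/∂x` into an `x`-derivative of the
  -- momentum, the form in which it cancels under symmetrization.
  rw [fderiv_momentum hℓ hΩ hq (σ q.1 b, 0) a, fderiv_fderiv_symm hℓ hΩ hq, ← h4,
    fderiv_fderiv_symm hp hΩ hq]
  have h5 : ((σ q.1 a, fderiv ℝ s q (0, a)) : X × F) =
      (σ q.1 a, 0) + (0, fderiv ℝ s q (0, a)) := by simp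
  rw [h5, map_add, add_apply]
  ring

/-- The compatibility of the fibre Hessian with the Euler-Lagrange field. -/
theorem EulerLagrangeAt.metric_identity {σ : X → F →L[ℝ] X} {c : X → F →L[ℝ] F →L[ℝ] F}
    {s : X × F → F} (hc : ∀ x f f', c x f f' = - c x f' f) (hℓ : ContDiffOn ℝ ∞ ℓ Ω)
    (hΩ : IsOpen Ω) (hs : DifferentiableAt ℝ s q) (hEL : ∀ q ∈ Ω, EulerLagrangeAt σ c ℓ s q)
    (hq : q ∈ Ω) (a b : F) :
    2 * fderiv ℝ (fderiv ℝ (momentum ℓ)) q (σ q.1 q.2, s q) (0, a) b =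
      fderiv ℝ (momentum ℓ) q (0, c q.1 q.2 a - fderiv ℝ s q (0, a)) b +
      fderiv ℝ (momentum ℓ) q (0, a) (c q.1 q.2 b - fderiv ℝ s q (0, b)) := by
  have h1 := EulerLagrangeAt.fibre_deriv hℓ hΩ hs hEL hq a b
  have h2 := EulerLagrangeAt.fibre_deriv hℓ hΩ hs hEL hq b a
  -- The copy with `a` and `b` exchanged is brought to the same shape. In the sum of the two copies,
  -- the terms `dp(σ a, 0) b`, `dp(σ b, 0) a` and `p(c(a, b))` cancel.
  rw [← fderiv_fderiv_momentum_symm hℓ hΩ hq, hc q.1 b a, map_neg,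
    fderiv_momentum_symm hℓ hΩ hq b, fderiv_momentum_symm hℓ hΩ hq _ a] at h2
  rw [fderiv_momentum_symm hℓ hΩ hq _ b, map_sub, map_sub,
    ← fderiv_momentum_symm hℓ hΩ hq _ b, ← fderiv_momentum_symm hℓ hΩ hq _ b]
  linarith

end Calculus

end LieAlgebroid

end

noncomputable section

namespace LieAlgebroid

open ChartField

set_option linter.unusedSectionVars false

/-! ### The Lagrangian section in coordinates -/

section Lagrangian

variable {EM : Type*} [NormedAddCommGroup EM] [NormedSpace ℝ EM] [FiniteDimensional ℝ EM]
  {M : Type*} [TopologicalSpace M] [T2Space M] [ChartedSpace EM M] [IsManifold 𝓘(ℝ, EM) ∞ M]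
  {F : Type*} [NormedAddCommGroup F] [NormedSpace ℝ F] [FiniteDimensional ℝ F]
  {E : M → Type*} [TopologicalSpace (TotalSpace F E)]
  [∀ x, AddCommGroup (E x)] [∀ x, Module ℝ (E x)] [∀ x, TopologicalSpace (E x)]
  [FiberBundle F E] [VectorBundle ℝ F E] [ContMDiffVectorBundle ∞ F E 𝓘(ℝ, EM)]
  (A : LieAlgebroid EM F E)

variable (EM) in
/-- A function on the total space read in the chart at `w₀`. -/
def funC (w₀ : TotalSpace F E) (L : TotalSpace F E → ℝ) : EM × F → ℝ := L ∘ (totChart EM w₀).symm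

variable {w₀ : TotalSpace F E} {V : Set (TotalSpace F E)} {q : EM × F} {L : TotalSpace F E → ℝ}

theorem contDiffOn_funC (hL : ContMDiffOn (𝓘(ℝ, EM).prod 𝓘(ℝ, F)) 𝓘(ℝ, ℝ) ∞ L V)
    (hVo : IsOpen V) (hV : V ⊆ frameDom EM w₀) :
    ContDiffOn ℝ ∞ (funC EM w₀ L) (coordSet EM w₀ V) :=
  (contMDiffOn_iff_chart hVo (hV.trans (frameDom_subset w₀))).1 hL

theorem IsSectionOn.mono {A : LieAlgebroid EM F E} {V V' : Set (TotalSpace F E)}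
    {ρ : ProlField EM F E} (h : A.IsSectionOn V ρ) (hV : V' ⊆ V) : A.IsSectionOn V' ρ :=
  ⟨fun w hw ↦ h.mem w (hV hw), h.smooth_fst.mono hV, h.smooth_snd.mono hV⟩

/-- Since the chart is linear on fibres, the iterated one-variable derivative is a second partial
derivative in `y`. -/
theorem fibreHess_eq (hL : ContDiffOn ℝ ∞ (funC EM w₀ L) (coordSet EM w₀ V)) (hVo : IsOpen V)
    (hq : q ∈ coordSet EM w₀ V) (a b : E ((totChart EM w₀).symm q).proj) :
    fibreHess L ((totChart EM w₀).symm q) a b =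
      fderiv ℝ (momentum (funC EM w₀ L)) q (0, fibCoord F E w₀.proj _ a)
        (fibCoord F E w₀.proj _ b) := by
  set a' := fibCoord F E w₀.proj _ a with ha'
  set b' := fibCoord F E w₀.proj _ b with hb'
  have hΩ := isOpen_coordSet (EM := EM) (w₀ := w₀) hVo
  have hs := (totChart EM w₀).map_target hq.1
  have hline : ∀ s t : ℝ, L ⟨((totChart EM w₀).symm q).proj,
      ((totChart EM w₀).symm q).2 + s • a + t • b⟩ =
      funC EM w₀ L (q + s • ((0, a') : EM × F) + t • ((0, b') : EM × F)) := by
    intro s t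
    have hs1 : (⟨((totChart EM w₀).symm q).proj, ((totChart EM w₀).symm q).2 + s • a⟩ :
        TotalSpace F E) ∈ (totChart EM w₀).source := by
      have h' := mem_totChart_source.1 hs
      exact mem_totChart_source.2 h'
    have hs2 : (⟨((totChart EM w₀).symm q).proj, ((totChart EM w₀).symm q).2 + s • a + t • b⟩ :
        TotalSpace F E) ∈ (totChart EM w₀).source := by
      have h' := mem_totChart_source.1 hs
      exact mem_totChart_source.2 h'
    have h1 := totChart_fibre_line hs a s
    have h2 := totChart_fibre_line hs1 b t
    rw [h1, (totChart EM w₀).right_inv hq.1] at h2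
    change _ = L ((totChart EM w₀).symm _)
    rw [← h2, (totChart EM w₀).left_inv hs2]
  have hn : ∀ᶠ s in 𝓝 (0 : ℝ), q + s • ((0, a') : EM × F) ∈ coordSet EM w₀ V := by
    refine (hasDerivAt_line q ((0, a') : EM × F)).continuousAt.eventually ?_
    beta_reduce
    rw [zero_smul, add_zero]
    exact hΩ.mem_nhds hq
  -- The inner derivative is identified only for small `s`, where the line stays in the domain of
  -- smoothness; the outer derivative at `0` needs no more.
  have hin : (fun s : ℝ ↦ deriv (fun t : ℝ ↦ L ⟨((totChart EM w₀).symm q).proj,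
      ((totChart EM w₀).symm q).2 + s • a + t • b⟩) 0) =ᶠ[𝓝 0]
      fun s ↦ momentum (funC EM w₀ L) (q + s • ((0, a') : EM × F)) b' := by
    filter_upwards [hn] with s hs'
    simp only [hline]
    exact (hasDerivAt_comp_line (differentiableAt_of_contDiffOn hL hΩ hs') (0, b')).deriv
  rw [fibreHess, hin.deriv_eq]
  have h3 := (hasDerivAt_comp_line (differentiableAt_of_contDiffOn (contDiffOn_momentum hL hΩ) hΩ hq)
    ((0, a') : EM × F)).clm_apply (hasDerivAt_const (0 : ℝ) b')
  rw [h3.deriv]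
  simp

theorem regular_coord (hL : ContDiffOn ℝ ∞ (funC EM w₀ L) (coordSet EM w₀ V)) (hVo : IsOpen V)
    (hreg : IsRegularOn L V) (hq : q ∈ coordSet EM w₀ V) {f : F}
    (hf : ∀ f', fderiv ℝ (momentum (funC EM w₀ L)) q (0, f) f' = 0) : f = 0 := by
  have hb := symm_proj_mem_baseSet hq.1
  have h := hreg _ hq.2 (fibSymm F E w₀.proj _ f) fun b ↦ by
    rw [fibreHess_eq hL hVo hq, fibCoord_fibSymm hb, hf]
  rw [← fibCoord_fibSymm hb f, h, map_zero]

theorem cartanOne_eq (hL : ContDiffOn ℝ ∞ (funC EM w₀ L) (coordSet EM w₀ V)) (hVo : IsOpen V)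
    (ρ : ProlField EM F E) (hq : q ∈ coordSet EM w₀ V) :
    cartanOne L ρ ((totChart EM w₀).symm q) = momentum (funC EM w₀ L) q (fstC w₀ ρ q) := by
  rw [cartanOne, dirDeriv_eq hq.1
    (differentiableAt_of_contDiffOn hL (isOpen_coordSet hVo) hq)]
  change fderiv ℝ (funC EM w₀ L) q (sndC w₀ (vertEndo EM ρ) q) = _
  rw [sndC_vertEndo ρ hq.1, momentum_apply]

theorem hasFDerivAt_cartanOne (hL : ContDiffOn ℝ ∞ (funC EM w₀ L) (coordSet EM w₀ V))
    (hVo : IsOpen V) {ρ : ProlField EM F E} (hρ : DifferentiableAt ℝ (fstC w₀ ρ) q)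
    (hq : q ∈ coordSet EM w₀ V) :
    HasFDerivAt (cartanOne L ρ ∘ (totChart EM w₀).symm)
      ((momentum (funC EM w₀ L) q).comp (fderiv ℝ (fstC w₀ ρ) q) +
        (fderiv ℝ (momentum (funC EM w₀ L)) q).flip (fstC w₀ ρ q)) q := by
  have hΩ := isOpen_coordSet (EM := EM) (w₀ := w₀) hVo
  have h := (differentiableAt_of_contDiffOn (contDiffOn_momentum hL hΩ) hΩ hq).hasFDerivAt.clm_apply
    hρ.hasFDerivAt
  refine h.congr_of_eventuallyEq ?_
  filter_upwards [hΩ.mem_nhds hq] with q' hq' using cartanOne_eq hL hVo ρ hq'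

/-- The derivatives of the components in `ρ₁(θ_L(ρ₂)) - ρ₂(θ_L(ρ₁))` are exactly those in `θ_L([ρ₁,
ρ₂])`. What survives depends only on values at the point. -/
theorem cartanTwo_eq (hL : ContDiffOn ℝ ∞ (funC EM w₀ L) (coordSet EM w₀ V)) (hVo : IsOpen V)
    (hV : V ⊆ frameDom EM w₀) {ρ₁ ρ₂ : ProlField EM F E} (h1 : A.IsSectionOn V ρ₁)
    (h2 : A.IsSectionOn V ρ₂) (hq : q ∈ coordSet EM w₀ V) :
    A.cartanTwo L ρ₁ ρ₂ ((totChart EM w₀).symm q) =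
      fderiv ℝ (momentum (funC EM w₀ L)) q (sndC w₀ ρ₁ q) (fstC w₀ ρ₂ q) -
      fderiv ℝ (momentum (funC EM w₀ L)) q (sndC w₀ ρ₂ q) (fstC w₀ ρ₁ q) -
      momentum (funC EM w₀ L) q (A.structC w₀.proj q.1 (fstC w₀ ρ₁ q) (fstC w₀ ρ₂ q)) := by
  have hΩ := isOpen_coordSet (EM := EM) (w₀ := w₀) hVo
  obtain ⟨hm1, hf1, -⟩ := (A.isSectionOn_iff ρ₁ hVo hV).1 h1
  obtain ⟨hm2, hf2, -⟩ := (A.isSectionOn_iff ρ₂ hVo hV).1 h2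
  have hd1 := differentiableAt_of_contDiffOn hf1 hΩ hq
  have hd2 := differentiableAt_of_contDiffOn hf2 hΩ hq
  have hc1 := hasFDerivAt_cartanOne hL hVo hd1 hq
  have hc2 := hasFDerivAt_cartanOne hL hVo hd2 hq
  rw [cartanTwo, dirDeriv_eq hq.1 hc1.differentiableAt, dirDeriv_eq hq.1 hc2.differentiableAt,
    cartanOne_eq hL hVo _ hq, A.fstC_prolBracket hq.1 (hV hq.2) hd1 hd2 (hm1 q hq) (hm2 q hq),
    hc1.fderiv, hc2.fderiv]
  change ((momentum (funC EM w₀ L) q).comp (fderiv ℝ (fstC w₀ ρ₂) q) +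
      (fderiv ℝ (momentum (funC EM w₀ L)) q).flip (fstC w₀ ρ₂ q)) (sndC w₀ ρ₁ q) -
    ((momentum (funC EM w₀ L) q).comp (fderiv ℝ (fstC w₀ ρ₁) q) +
      (fderiv ℝ (momentum (funC EM w₀ L)) q).flip (fstC w₀ ρ₁ q)) (sndC w₀ ρ₂ q) - _ = _
  simp only [add_apply, ContinuousLinearMap.comp_apply, ContinuousLinearMap.flip_apply, map_add,
    map_sub]
  ring

/-- In the derivative of `p · y - ℓ`, the term `p(v)` from varying `y` cancels the fibre derivative
of `ℓ`. -/
theorem dirDeriv_energy_eq (hL : ContDiffOn ℝ ∞ (funC EM w₀ L) (coordSet EM w₀ V)) (hVo : IsOpen V)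
    (ρ : ProlField EM F E) (hq : q ∈ coordSet EM w₀ V) :
    dirDeriv EM (energy EM L) ((totChart EM w₀).symm q) (ρ ((totChart EM w₀).symm q)).2 =
      fderiv ℝ (momentum (funC EM w₀ L)) q (sndC w₀ ρ q) q.2 -
        fderiv ℝ (funC EM w₀ L) q ((sndC w₀ ρ q).1, 0) := by
  have hΩ := isOpen_coordSet (EM := EM) (w₀ := w₀) hVo
  have he : energy EM L ∘ (totChart EM w₀).symm =ᶠ[𝓝 q]
      fun q' ↦ momentum (funC EM w₀ L) q' q'.2 - funC EM w₀ L q' := by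
    filter_upwards [hΩ.mem_nhds hq] with q' hq'
    rw [Function.comp_apply, energy, dirDeriv_eq hq'.1 (differentiableAt_of_contDiffOn hL hΩ hq')]
    change fderiv ℝ (funC EM w₀ L) q' (sndC w₀ (euler EM F E) q') - _ = _
    rw [sndC_euler hq'.1]
    rfl
  have hd := ((differentiableAt_of_contDiffOn (contDiffOn_momentum hL hΩ) hΩ
    hq).hasFDerivAt.clm_apply (hasFDerivAt_snd (𝕜 := ℝ) (p := q))).sub
    (differentiableAt_of_contDiffOn hL hΩ hq).hasFDerivAt
  have hd2 := hd.congr_of_eventuallyEq he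
  rw [dirDeriv_eq hq.1 hd2.differentiableAt, hd2.fderiv]
  change ((momentum (funC EM w₀ L) q).comp (ContinuousLinearMap.snd ℝ EM F) +
    (fderiv ℝ (momentum (funC EM w₀ L)) q).flip q.2 - fderiv ℝ (funC EM w₀ L) q) (sndC w₀ ρ q) = _
  have h5 : sndC w₀ ρ q = ((sndC w₀ ρ q).1, 0) + (0, (sndC w₀ ρ q).2) := by simp
  have h6 : fderiv ℝ (funC EM w₀ L) q (sndC w₀ ρ q) =
      fderiv ℝ (funC EM w₀ L) q ((sndC w₀ ρ q).1, 0) +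
        momentum (funC EM w₀ L) q (sndC w₀ ρ q).2 := by
    rw [momentum_apply, ← map_add, ← h5]
  simp only [add_apply, sub_apply, ContinuousLinearMap.comp_apply, ContinuousLinearMap.flip_apply,
    ContinuousLinearMap.coe_snd', h6]
  ring

/-- A section is Lagrangian exactly if it is a semispray which solves the Euler-Lagrange
equation. -/
theorem isLagrangianSectionOn_iff
    (hL : ContMDiffOn (𝓘(ℝ, EM).prod 𝓘(ℝ, F)) 𝓘(ℝ, ℝ) ∞ L V) (hreg : IsRegularOn L V)
    (hVo : IsOpen V) (hV : V ⊆ frameDom EM w₀) (S : ProlField EM F E) :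
    A.IsLagrangianSectionOn V L S ↔ A.IsSectionOn V S ∧ ∀ q ∈ coordSet EM w₀ V,
      fstC w₀ S q = q.2 ∧ EulerLagrangeAt (A.anchorC w₀.proj) (A.structC w₀.proj)
        (funC EM w₀ L) (fun q ↦ (sndC w₀ S q).2) q := by
  have hLc := contDiffOn_funC hL hVo hV
  have hΩ := isOpen_coordSet (EM := EM) (w₀ := w₀) hVo
  constructor
  · rintro ⟨hS, h⟩
    refine ⟨hS, fun q hq ↦ ?_⟩
    have hm := ((A.isSectionOn_iff S hVo hV).1 hS).1 q hq
    -- Sections with constant coordinates suffice as tests, since both sides are pointwise in the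
    -- test section.
    have key : ∀ z v : F,
        fderiv ℝ (momentum (funC EM w₀ L)) q (sndC w₀ S q) z -
        fderiv ℝ (momentum (funC EM w₀ L)) q (A.anchorC w₀.proj q.1 z, v) (fstC w₀ S q) -
        momentum (funC EM w₀ L) q (A.structC w₀.proj q.1 (fstC w₀ S q) z) =
        -(fderiv ℝ (momentum (funC EM w₀ L)) q (A.anchorC w₀.proj q.1 z, v) q.2 -
        fderiv ℝ (funC EM w₀ L) q (A.anchorC w₀.proj q.1 z, 0)) := by
      intro z v
      have hρ := A.isSectionOn_mkField (z := fun _ ↦ z) (v := fun _ ↦ v) hVo hV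
        contDiffOn_const contDiffOn_const
      have h1 := h V subset_rfl hVo _ hρ _ hq.2
      rw [A.cartanTwo_eq hLc hVo hV hS hρ hq, dirDeriv_energy_eq hLc hVo _ hq,
        fstC_mkField _ _ hq.1, sndC_mkField _ _ hq.1] at h1
      exact h1
    have hz : fstC w₀ S q = q.2 := by
      refine sub_eq_zero.1 (regular_coord hLc hVo hreg hq fun v ↦ ?_)
      -- With `z = 0` only `g(v, z_S) = g(v, y)` remains, and regularity gives `z_S = y`.
      have h0 := key 0 v
      rw [fderiv_momentum_symm hLc hΩ hq, map_sub]
      simp only [map_zero, Prod.mk_zero_zero] at h0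
      linarith
    refine ⟨hz, fun f ↦ ?_⟩
    -- Once `z_S = y`, the terms `dp(·) z_S` and `dp(·) y` cancel, so the choice of `v` does not
    -- matter.
    have h1 := key f 0
    have hX : ((A.anchorC w₀.proj q.1 q.2, (sndC w₀ S q).2) : EM × F) = sndC w₀ S q :=
      Prod.ext (by rw [hm, hz]) rfl
    rw [hz] at h1
    change fderiv ℝ (momentum (funC EM w₀ L)) q (A.anchorC w₀.proj q.1 q.2, (sndC w₀ S q).2) f - _
      = _
    rw [hX]
    linarith
  · rintro ⟨hS, h⟩
    refine ⟨hS, fun V' hV' hVo' ρ hρ w hw ↦ ?_⟩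
    have hV'' := hV'.trans hV
    have hws := frameDom_subset w₀ (hV'' hw)
    have hq : totChart EM w₀ w ∈ coordSet EM w₀ V' := mem_coordSet hw hws
    rw [← (totChart EM w₀).left_inv hws]
    generalize totChart EM w₀ w = q at hq
    have hqV : q ∈ coordSet EM w₀ V := ⟨hq.1, hV' hq.2⟩
    have hLc' : ContDiffOn ℝ ∞ (funC EM w₀ L) (coordSet EM w₀ V') :=
      hLc.mono fun q hq ↦ ⟨hq.1, hV' hq.2⟩
    have hm := ((A.isSectionOn_iff S hVo hV).1 hS).1 q hqV
    have hmρ := ((A.isSectionOn_iff ρ hVo' hV'').1 hρ).1 q hq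
    obtain ⟨hz, hEL⟩ := h q hqV
    rw [A.cartanTwo_eq hLc' hVo' hV'' (hS.mono hV') hρ hq, dirDeriv_energy_eq hLc' hVo' _ hq, hmρ]
    have h1 := hEL (fstC w₀ ρ q)
    have hX : ((A.anchorC w₀.proj q.1 q.2, (sndC w₀ S q).2) : EM × F) = sndC w₀ S q :=
      Prod.ext (by rw [hm, hz]) rfl
    change fderiv ℝ (momentum (funC EM w₀ L)) q (A.anchorC w₀.proj q.1 q.2, (sndC w₀ S q).2) _ - _
      = _ at h1
    rw [hX] at h1
    rw [hz]
    linarith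

end Lagrangian

end LieAlgebroid

end

noncomputable section

namespace LieAlgebroid

open ChartField

set_option linter.unusedSectionVars false

/-! ### Existence and uniqueness of the Lagrangian section -/

section Existence

variable {EM : Type*} [NormedAddCommGroup EM] [NormedSpace ℝ EM] [FiniteDimensional ℝ EM]
  {M : Type*} [TopologicalSpace M] [T2Space M] [ChartedSpace EM M] [IsManifold 𝓘(ℝ, EM) ∞ M]
  {F : Type*} [NormedAddCommGroup F] [NormedSpace ℝ F] [FiniteDimensional ℝ F]
  {E : M → Type*} [TopologicalSpace (TotalSpace F E)]
  [∀ x, AddCommGroup (E x)] [∀ x, Module ℝ (E x)] [∀ x, TopologicalSpace (E x)]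
  [FiberBundle F E] [VectorBundle ℝ F E] [ContMDiffVectorBundle ∞ F E 𝓘(ℝ, EM)]
  (A : LieAlgebroid EM F E)

variable {w₀ : TotalSpace F E} {U V : Set (TotalSpace F E)} {q : EM × F} {L : TotalSpace F E → ℝ}

theorem IsLagrangianSectionOn.mono {A : LieAlgebroid EM F E} {S : ProlField EM F E}
    (h : A.IsLagrangianSectionOn U L S) (hV : V ⊆ U) : A.IsLagrangianSectionOn V L S :=
  ⟨h.1.mono hV, fun V' hV' ↦ h.2 V' (hV'.trans hV)⟩

theorem IsSectionOn.congr {A : LieAlgebroid EM F E} {ρ ρ' : ProlField EM F E}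
    (h : A.IsSectionOn V ρ) (he : ∀ w ∈ V, ρ' w = ρ w) : A.IsSectionOn V ρ' :=
  ⟨fun w hw ↦ by rw [he w hw]; exact h.mem w hw,
    h.smooth_fst.congr fun w hw ↦ by rw [he w hw],
    h.smooth_snd.congr fun w hw ↦ by rw [he w hw]⟩

theorem isSectionOn_of_local {ρ : ProlField EM F E}
    (h : ∀ w ∈ U, ∃ V, IsOpen V ∧ w ∈ V ∧ A.IsSectionOn V ρ) : A.IsSectionOn U ρ := by
  refine ⟨fun w hw ↦ ?_, fun w hw ↦ ?_, fun w hw ↦ ?_⟩ <;> obtain ⟨V, hVo, hwV, hV⟩ := h w hw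
  · exact hV.mem w hwV
  · exact (hV.smooth_fst.contMDiffAt (hVo.mem_nhds hwV)).contMDiffWithinAt
  · exact (hV.smooth_snd.contMDiffAt (hVo.mem_nhds hwV)).contMDiffWithinAt

theorem isLagrangianSectionOn_of_local {S : ProlField EM F E}
    (h : ∀ w ∈ U, ∃ V, IsOpen V ∧ w ∈ V ∧ A.IsLagrangianSectionOn V L S) :
    A.IsLagrangianSectionOn U L S := by
  refine ⟨A.isSectionOn_of_local fun w hw ↦ ?_, fun V' hV' hVo' ρ hρ w hw ↦ ?_⟩
  · obtain ⟨V, hVo, hwV, hV⟩ := h w hw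
    exact ⟨V, hVo, hwV, hV.1⟩
  · obtain ⟨V, hVo, hwV, hV⟩ := h w (hV' hw)
    exact hV.2 (V ∩ V') inter_subset_left (hVo.inter hVo') ρ (hρ.mono inter_subset_right) w
      ⟨hwV, hw⟩

theorem isOpen_inter_frameDom (hU : IsOpen U) (w₀ : TotalSpace F E) :
    IsOpen (U ∩ frameDom EM w₀) := hU.inter (isOpen_frameDom w₀)

theorem totChart_mem_coordSet {w : TotalSpace F E} (hw : w ∈ U) :
    totChart EM w w ∈ coordSet EM w (U ∩ frameDom EM w) :=
  mem_coordSet ⟨hw, mem_frameDom_self w⟩ (mem_extChartAt_source w)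

/-- The defining equation involves derivatives of `S` through the bracket, but its coordinate form
involves only values of `S`, so agreement on the open set can be substituted directly. -/
theorem IsLagrangianSectionOn.congr {A : LieAlgebroid EM F E} {S S' : ProlField EM F E}
    (hL : ContMDiffOn (𝓘(ℝ, EM).prod 𝓘(ℝ, F)) 𝓘(ℝ, ℝ) ∞ L V) (hreg : IsRegularOn L V)
    (hVo : IsOpen V) (hV : V ⊆ frameDom EM w₀) (h : A.IsLagrangianSectionOn V L S)
    (he : ∀ w ∈ V, S' w = S w) : A.IsLagrangianSectionOn V L S' := by
  rw [A.isLagrangianSectionOn_iff hL hreg hVo hV] at h ⊢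
  refine ⟨h.1.congr he, fun q hq ↦ ?_⟩
  have h1 : fstC w₀ S' q = fstC w₀ S q := by rw [fstC, he _ hq.2]; rfl
  have h2 : sndC w₀ S' q = sndC w₀ S q := by
    change totD w₀ _ (S' _).2 = totD w₀ _ (S _).2
    rw [he _ hq.2]
  obtain ⟨h3, h4⟩ := h.2 q hq
  refine ⟨h1.trans h3, fun f ↦ ?_⟩
  have := h4 f
  simp only [h2]
  exact this

theorem IsLagrangianSectionOn.unique {A : LieAlgebroid EM F E} {S S' : ProlField EM F E}
    (hL : ContMDiffOn (𝓘(ℝ, EM).prod 𝓘(ℝ, F)) 𝓘(ℝ, ℝ) ∞ L U) (hreg : IsRegularOn L U)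
    (hU : IsOpen U) (h : A.IsLagrangianSectionOn U L S) (h' : A.IsLagrangianSectionOn U L S')
    {w : TotalSpace F E} (hw : w ∈ U) : S' w = S w := by
  have hVo : IsOpen (U ∩ frameDom EM w) := isOpen_inter_frameDom hU w
  have hVU : U ∩ frameDom EM w ⊆ U := inter_subset_left
  have hV : U ∩ frameDom EM w ⊆ frameDom EM w := inter_subset_right
  have hregV : IsRegularOn L (U ∩ frameDom EM w) := fun w' hw' ↦ hreg w' (hVU hw')
  have hq := totChart_mem_coordSet (EM := EM) hw
  have h1 := (A.isLagrangianSectionOn_iff (hL.mono hVU) hregV hVo hV S).1 (h.mono hVU)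
  have h2 := (A.isLagrangianSectionOn_iff (hL.mono hVU) hregV hVo hV S').1 (h'.mono hVU)
  have hm1 := ((A.isSectionOn_iff S hVo hV).1 h1.1).1 _ hq
  have hm2 := ((A.isSectionOn_iff S' hVo hV).1 h2.1).1 _ hq
  obtain ⟨hz1, hE1⟩ := h1.2 _ hq
  obtain ⟨hz2, hE2⟩ := h2.2 _ hq
  rw [← (totChart EM w).left_inv (mem_extChartAt_source w)]
  generalize totChart EM w w = q at *
  refine ext_coord hq.1 (hz2.trans hz1.symm) (Prod.ext (by rw [hm1, hm2, hz1, hz2]) ?_)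
  refine sub_eq_zero.1 (regular_coord (contDiffOn_funC (hL.mono hVU) hVo hV) hVo hregV hq
    fun f ↦ ?_)
  have e1 := hE1 f
  have e2 := hE2 f
  -- Two solutions share their base part, so the difference of their Euler-Lagrange equations puts
  -- the difference of fibre parts in the kernel of the Hessian.
  have e3 : ((0, (sndC w S' q).2 - (sndC w S q).2) : EM × F) =
      (A.anchorC w.proj q.1 q.2, (sndC w S' q).2) - (A.anchorC w.proj q.1 q.2, (sndC w S q).2) := by
    simp
  rw [e3, map_sub, sub_apply]
  linarith

/-- The Euler-Lagrange equation, solved for the fibre component of the semispray. -/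
def lagrangeForce (σ : EM → F →L[ℝ] EM) (c : EM → F →L[ℝ] F →L[ℝ] F) (ℓ : EM × F → ℝ)
    (q : EM × F) : F :=
  ((fderiv ℝ (momentum ℓ) q).comp (ContinuousLinearMap.inr ℝ EM F)).inverse
    (((fderiv ℝ ℓ q).comp (ContinuousLinearMap.inl ℝ EM F)).comp (σ q.1) +
      (momentum ℓ q).comp (c q.1 q.2) - fderiv ℝ (momentum ℓ) q (σ q.1 q.2, 0))

/-- A nondegenerate bilinear form identifies `F` with its dual: the induced map is injective between
spaces of equal finite dimension. -/
theorem exists_equiv_fibreHess {ℓ : EM × F → ℝ}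
    (h : ∀ f : F, (∀ f', fderiv ℝ (momentum ℓ) q (0, f) f' = 0) → f = 0) :
    ∃ e : F ≃L[ℝ] (F →L[ℝ] ℝ),
      (e : F →L[ℝ] F →L[ℝ] ℝ) =
        (fderiv ℝ (momentum ℓ) q).comp (ContinuousLinearMap.inr ℝ EM F) := by
  set G := (fderiv ℝ (momentum ℓ) q).comp (ContinuousLinearMap.inr ℝ EM F)
  have hinj : Function.Injective G.toLinearMap := by
    rw [injective_iff_map_eq_zero]
    intro f hf
    exact h f fun f' ↦ congrArg (fun T : F →L[ℝ] ℝ ↦ T f') hf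
  have hdim : Module.finrank ℝ F = Module.finrank ℝ (F →L[ℝ] ℝ) := by
    rw [← (LinearMap.toContinuousLinearMap (𝕜 := ℝ) (E := F) (F' := ℝ)).finrank_eq]
    exact (Subspace.dual_finrank_eq (K := ℝ) (V := F)).symm
  refine ⟨(LinearEquiv.ofInjective G.toLinearMap hinj |>.trans
    (LinearEquiv.ofEq _ ⊤ (LinearMap.range_eq_top.2
      ((LinearMap.injective_iff_surjective_of_finrank_eq_finrank hdim).1 hinj))) |>.trans
    (Submodule.topEquiv)).toContinuousLinearEquiv, ?_⟩
  ext f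
  rfl

theorem eulerLagrangeAt_lagrangeForce {σ : EM → F →L[ℝ] EM} {c : EM → F →L[ℝ] F →L[ℝ] F}
    {ℓ : EM × F → ℝ} (h : ∀ f : F, (∀ f', fderiv ℝ (momentum ℓ) q (0, f) f' = 0) → f = 0) :
    EulerLagrangeAt σ c ℓ (lagrangeForce σ c ℓ) q := by
  intro f
  obtain ⟨e, he⟩ := exists_equiv_fibreHess h
  have h1 : fderiv ℝ (momentum ℓ) q (0, lagrangeForce σ c ℓ q) =
      ((fderiv ℝ ℓ q).comp (ContinuousLinearMap.inl ℝ EM F)).comp (σ q.1) +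
      (momentum ℓ q).comp (c q.1 q.2) - fderiv ℝ (momentum ℓ) q (σ q.1 q.2, 0) := by
    change (fderiv ℝ (momentum ℓ) q).comp (ContinuousLinearMap.inr ℝ EM F)
      (lagrangeForce σ c ℓ q) = _
    rw [lagrangeForce, ← he, ContinuousLinearMap.inverse_equiv]
    simp
  have h2 : ((σ q.1 q.2, lagrangeForce σ c ℓ q) : EM × F) =
      (σ q.1 q.2, 0) + (0, lagrangeForce σ c ℓ q) := by simp
  rw [h2, map_add, h1]
  simp

set_option synthInstance.maxHeartbeats 200000 in
theorem contDiffOn_lagrangeForce {σ : EM → F →L[ℝ] EM} {c : EM → F →L[ℝ] F →L[ℝ] F}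
    {ℓ : EM × F → ℝ} {Ω : Set (EM × F)} (hΩ : IsOpen Ω) (hℓ : ContDiffOn ℝ ∞ ℓ Ω)
    (hσ : ContDiffOn ℝ ∞ (fun q : EM × F ↦ σ q.1) Ω)
    (hc : ContDiffOn ℝ ∞ (fun q : EM × F ↦ c q.1) Ω)
    (h : ∀ q ∈ Ω, ∀ f : F, (∀ f', fderiv ℝ (momentum ℓ) q (0, f) f' = 0) → f = 0) :
    ContDiffOn ℝ ∞ (lagrangeForce σ c ℓ) Ω := by
  have hp := contDiffOn_momentum hℓ hΩ
  have hdp := contDiffOn_fderiv_top hp hΩ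
  have hsnd : ContDiffOn ℝ ∞ (fun q : EM × F ↦ q.2) Ω := contDiffOn_snd
  have hG : ContDiffOn ℝ ∞ (fun q ↦ (fderiv ℝ (momentum ℓ) q).comp
      (ContinuousLinearMap.inr ℝ EM F)) Ω := hdp.clm_comp contDiffOn_const
  have hinv : ContDiffOn ℝ ∞ (fun q ↦ ((fderiv ℝ (momentum ℓ) q).comp
      (ContinuousLinearMap.inr ℝ EM F)).inverse) Ω := by
    intro q hq
    obtain ⟨e, he⟩ := exists_equiv_fibreHess (h q hq)
    -- Inversion of linear maps is smooth at an invertible one, so the solution depends smoothly on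
    -- `q`.
    have h1 := contDiffAt_map_inverse (n := ∞) e
    rw [he] at h1
    exact h1.comp_contDiffWithinAt q (hG q hq)
  have hrhs : ContDiffOn ℝ ∞ (fun q : EM × F ↦
      ((fderiv ℝ ℓ q).comp (ContinuousLinearMap.inl ℝ EM F)).comp (σ q.1) +
      (momentum ℓ q).comp (c q.1 q.2) - fderiv ℝ (momentum ℓ) q (σ q.1 q.2, 0)) Ω :=
    ((((contDiffOn_fderiv_top hℓ hΩ).clm_comp contDiffOn_const).clm_comp hσ).add
      (hp.clm_comp (hc.clm_apply hsnd))).sub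
        (hdp.clm_apply ((hσ.clm_apply hsnd).prodMk contDiffOn_const))
  exact hinv.clm_apply hrhs

theorem exists_isLagrangianSectionOn_local
    (hL : ContMDiffOn (𝓘(ℝ, EM).prod 𝓘(ℝ, F)) 𝓘(ℝ, ℝ) ∞ L V) (hreg : IsRegularOn L V)
    (hVo : IsOpen V) (hV : V ⊆ frameDom EM w₀) :
    ∃ S : ProlField EM F E, A.IsLagrangianSectionOn V L S := by
  have hΩ := isOpen_coordSet (EM := EM) (w₀ := w₀) hVo
  have hLc := contDiffOn_funC hL hVo hV
  have hr : ∀ q ∈ coordSet EM w₀ V, ∀ f : F,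
      (∀ f', fderiv ℝ (momentum (funC EM w₀ L)) q (0, f) f' = 0) → f = 0 :=
    fun q hq f hf ↦ regular_coord hLc hVo hreg hq hf
  have hs := contDiffOn_lagrangeForce hΩ hLc (A.contDiffOn_anchorC_fst hV)
    (A.contDiffOn_structC_fst hV) hr
  refine ⟨_, (A.isLagrangianSectionOn_iff hL hreg hVo hV _).2
    ⟨A.isSectionOn_mkField hVo hV contDiffOn_snd hs, fun q hq ↦ ⟨fstC_mkField _ _ hq.1, fun f ↦ ?_⟩⟩⟩
  beta_reduce
  rw [sndC_mkField _ _ hq.1]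
  exact eulerLagrangeAt_lagrangeForce (hr q hq) f

theorem exists_isLagrangianSectionOn
    (hL : ContMDiffOn (𝓘(ℝ, EM).prod 𝓘(ℝ, F)) 𝓘(ℝ, ℝ) ∞ L U) (hreg : IsRegularOn L U)
    (hU : IsOpen U) : ∃ S : ProlField EM F E, A.IsLagrangianSectionOn U L S := by
  have hregV : ∀ {V}, V ⊆ U → IsRegularOn L V := fun hV w' hw' ↦ hreg w' (hV hw')
  have hloc : ∀ w : TotalSpace F E, ∃ S : ProlField EM F E,
      A.IsLagrangianSectionOn (U ∩ frameDom EM w) L S := fun w ↦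
    A.exists_isLagrangianSectionOn_local (hL.mono inter_subset_left) (hregV inter_subset_left)
      (isOpen_inter_frameDom hU w) inter_subset_right
  choose S hS using hloc
  -- At each point the value of the local solution centred there is taken. By uniqueness this agrees
  -- on overlaps with the solution centred at any nearby point, so no partition of unity is needed.
  refine ⟨fun w ↦ S w w, A.isLagrangianSectionOn_of_local fun w hw ↦ ?_⟩
  refine ⟨U ∩ frameDom EM w, isOpen_inter_frameDom hU w, ⟨hw, mem_frameDom_self w⟩, ?_⟩
  refine (hS w).congr (hL.mono inter_subset_left) (hregV inter_subset_left)
    (isOpen_inter_frameDom hU w) inter_subset_right fun w' hw' ↦ ?_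
  have hsub : U ∩ frameDom EM w ∩ frameDom EM w' ⊆ U := fun _ h ↦ h.1.1
  exact IsLagrangianSectionOn.unique (U := U ∩ frameDom EM w ∩ frameDom EM w') (hL.mono hsub)
    (hregV hsub) ((isOpen_inter_frameDom hU w).inter (isOpen_frameDom w'))
    ((hS w).mono inter_subset_left) ((hS w').mono fun _ h ↦ ⟨h.1.1, h.2⟩)
    ⟨hw', mem_frameDom_self w'⟩

end Existence

end LieAlgebroid

end

noncomputable section

namespace LieAlgebroid

open ChartField

set_option linter.unusedSectionVars false

/-! ### The canonical connection and its metric property -/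

section Connection

variable {EM : Type*} [NormedAddCommGroup EM] [NormedSpace ℝ EM] [FiniteDimensional ℝ EM]
  {M : Type*} [TopologicalSpace M] [T2Space M] [ChartedSpace EM M] [IsManifold 𝓘(ℝ, EM) ∞ M]
  {F : Type*} [NormedAddCommGroup F] [NormedSpace ℝ F] [FiniteDimensional ℝ F]
  {E : M → Type*} [TopologicalSpace (TotalSpace F E)]
  [∀ x, AddCommGroup (E x)] [∀ x, Module ℝ (E x)] [∀ x, TopologicalSpace (E x)]
  [FiberBundle F E] [VectorBundle ℝ F E] [ContMDiffVectorBundle ∞ F E 𝓘(ℝ, EM)]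
  (A : LieAlgebroid EM F E)

variable {w₀ : TotalSpace F E} {U V : Set (TotalSpace F E)} {q : EM × F} {L : TotalSpace F E → ℝ}

theorem fstC_add (ρ₁ ρ₂ : ProlField EM F E) :
    fstC w₀ (fun w ↦ ρ₁ w + ρ₂ w) q = fstC w₀ ρ₁ q + fstC w₀ ρ₂ q := by
  simp [fstC]

theorem sndC_add (ρ₁ ρ₂ : ProlField EM F E) :
    sndC w₀ (fun w ↦ ρ₁ w + ρ₂ w) q = sndC w₀ ρ₁ q + sndC w₀ ρ₂ q :=
  map_add (totD w₀ _) _ _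

theorem fstC_smul (f : TotalSpace F E → ℝ) (ρ : ProlField EM F E) :
    fstC w₀ (fun w ↦ f w • ρ w) q = funC EM w₀ f q • fstC w₀ ρ q := by
  simp [fstC, funC]

theorem sndC_smul (f : TotalSpace F E → ℝ) (ρ : ProlField EM F E) :
    sndC w₀ (fun w ↦ f w • ρ w) q = funC EM w₀ f q • sndC w₀ ρ q :=
  map_smul (totD w₀ _) _ _

theorem fstC_neg (ρ : ProlField EM F E) : fstC w₀ (fun w ↦ - ρ w) q = - fstC w₀ ρ q := by
  simp [fstC]

theorem sndC_neg (ρ : ProlField EM F E) : sndC w₀ (fun w ↦ - ρ w) q = - sndC w₀ ρ q :=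
  map_neg (totD w₀ _) _

theorem fstC_hproj (P : ProlField EM F E → ProlField EM F E) (ρ : ProlField EM F E) :
    fstC w₀ (hproj P ρ) q = (1 / 2 : ℝ) • (fstC w₀ ρ q + fstC w₀ (P ρ) q) := by
  rw [← fstC_add]
  exact map_smul (fibCoord F E w₀.proj _) _ _

theorem sndC_hproj (P : ProlField EM F E → ProlField EM F E) (ρ : ProlField EM F E) :
    sndC w₀ (hproj P ρ) q = (1 / 2 : ℝ) • (sndC w₀ ρ q + sndC w₀ (P ρ) q) := by
  rw [← sndC_add]
  exact map_smul (totD w₀ _) _ _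

theorem fstC_vproj (P : ProlField EM F E → ProlField EM F E) (ρ : ProlField EM F E) :
    fstC w₀ (vproj P ρ) q = (1 / 2 : ℝ) • (fstC w₀ ρ q - fstC w₀ (P ρ) q) := by
  simp [fstC, vproj]

theorem sndC_vproj (P : ProlField EM F E → ProlField EM F E) (ρ : ProlField EM F E) :
    sndC w₀ (vproj P ρ) q = (1 / 2 : ℝ) • (sndC w₀ ρ q - sndC w₀ (P ρ) q) :=
  (map_smul (totD w₀ _) (1 / 2 : ℝ) _).trans (congrArg _ (map_sub (totD w₀ _) _ _))

/-- `S` is a section over `V` whose first component is the fibre coordinate. -/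
structure IsSprayCoord (w₀ : TotalSpace F E) (V : Set (TotalSpace F E))
    (S : ProlField EM F E) : Prop where
  isOpen : IsOpen V
  subset : V ⊆ frameDom EM w₀
  isSectionOn : A.IsSectionOn V S
  fst_eq : ∀ q ∈ coordSet EM w₀ V, fstC w₀ S q = q.2

variable {A} {S : ProlField EM F E}

namespace IsSprayCoord

theorem isOpen_coordSet (hS : A.IsSprayCoord w₀ V S) : IsOpen (coordSet EM w₀ V) :=
  LieAlgebroid.isOpen_coordSet hS.isOpen

theorem contDiffOn_snd (hS : A.IsSprayCoord w₀ V S) :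
    ContDiffOn ℝ ∞ (sndC w₀ S) (coordSet EM w₀ V) :=
  ((A.isSectionOn_iff S hS.isOpen hS.subset).1 hS.isSectionOn).2.2

theorem snd_fst_eq (hS : A.IsSprayCoord w₀ V S) (hq : q ∈ coordSet EM w₀ V) :
    (sndC w₀ S q).1 = A.anchorC w₀.proj q.1 q.2 := by
  rw [← hS.fst_eq q hq]
  exact ((A.isSectionOn_iff S hS.isOpen hS.subset).1 hS.isSectionOn).1 q hq

theorem hasFDerivAt_fst (hS : A.IsSprayCoord w₀ V S) (hq : q ∈ coordSet EM w₀ V) :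
    HasFDerivAt (fstC w₀ S) (ContinuousLinearMap.snd ℝ EM F) q := by
  refine hasFDerivAt_snd.congr_of_eventuallyEq ?_
  filter_upwards [hS.isOpen_coordSet.mem_nhds hq] with q' hq' using hS.fst_eq q' hq'

theorem differentiableAt_snd (hS : A.IsSprayCoord w₀ V S) (hq : q ∈ coordSet EM w₀ V) :
    DifferentiableAt ℝ (sndC w₀ S) q :=
  differentiableAt_of_contDiffOn hS.contDiffOn_snd hS.isOpen_coordSet hq

/-- The base component of a semispray is `σ(x) y`, which is linear along the fibre. -/
theorem fderiv_snd_vertical (hS : A.IsSprayCoord w₀ V S) (hq : q ∈ coordSet EM w₀ V) (f : F) :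
    fderiv ℝ (sndC w₀ S) q (0, f) =
      (A.anchorC w₀.proj q.1 f, fderiv ℝ (fun q ↦ (sndC w₀ S q).2) q (0, f)) := by
  have hd := hS.differentiableAt_snd hq
  have h1 := hasDerivAt_comp_line hd ((0, f) : EM × F)
  have h2 := hasDerivAt_comp_line hd.snd ((0, f) : EM × F)
  have hn : ∀ᶠ t in 𝓝 (0 : ℝ), q + t • ((0, f) : EM × F) ∈ coordSet EM w₀ V := by
    refine (hasDerivAt_line q ((0, f) : EM × F)).continuousAt.eventually ?_
    beta_reduce
    rw [zero_smul, add_zero]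
    exact hS.isOpen_coordSet.mem_nhds hq
  have h3 : HasDerivAt (fun t : ℝ ↦ (sndC w₀ S (q + t • ((0, f) : EM × F))).1)
      (A.anchorC w₀.proj q.1 f) 0 := by
    have h4 : HasDerivAt (fun t : ℝ ↦ A.anchorC w₀.proj q.1 (q.2 + t • f))
        (A.anchorC w₀.proj q.1 f) 0 :=
      (A.anchorC w₀.proj q.1).hasFDerivAt.comp_hasDerivAt 0 (hasDerivAt_line q.2 f)
    refine h4.congr_of_eventuallyEq ?_
    filter_upwards [hn] with t ht
    rw [hS.snd_fst_eq ht]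
    simp
  exact h1.unique (h3.prodMk h2)

/-- The bracket of a spray with a vertical field. -/
theorem bracket_vertical (hS : A.IsSprayCoord w₀ V S) (hq : q ∈ coordSet EM w₀ V)
    {ρ : ProlField EM F E} {v : EM × F → F} (hv : DifferentiableAt ℝ v q)
    (h1 : ∀ q ∈ coordSet EM w₀ V, fstC w₀ ρ q = 0)
    (h2 : ∀ q ∈ coordSet EM w₀ V, sndC w₀ ρ q = (0, v q)) :
    fstC w₀ (A.prolBracket S ρ) q = - v q ∧
    sndC w₀ (A.prolBracket S ρ) q = (- A.anchorC w₀.proj q.1 (v q),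
      fderiv ℝ v q (sndC w₀ S q) - fderiv ℝ (fun q ↦ (sndC w₀ S q).2) q (0, v q)) := by
  have hn := hS.isOpen_coordSet.mem_nhds hq
  have d1 : HasFDerivAt (fstC w₀ ρ) (0 : EM × F →L[ℝ] F) q :=
    (hasFDerivAt_const (0 : F) q).congr_of_eventuallyEq
      (by filter_upwards [hn] with q' hq' using h1 q' hq')
  have d2 : HasFDerivAt (sndC w₀ ρ) ((0 : EM × F →L[ℝ] EM).prod (fderiv ℝ v q)) q :=
    ((hasFDerivAt_const (0 : EM) q).prodMk hv.hasFDerivAt).congr_of_eventuallyEq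
      (by filter_upwards [hn] with q' hq' using h2 q' hq')
  have hf := hS.hasFDerivAt_fst hq
  constructor
  · rw [A.fstC_prolBracket hq.1 (hS.subset hq.2) hf.differentiableAt d1.differentiableAt
      (by rw [hS.snd_fst_eq hq, hS.fst_eq q hq]) (by rw [h2 q hq, h1 q hq, map_zero]),
      d1.fderiv, hf.fderiv, h1 q hq, h2 q hq]
    simp
  · rw [A.sndC_prolBracket hq.1 (hS.differentiableAt_snd hq) d2.differentiableAt, d2.fderiv, h2 q hq,
      hS.fderiv_snd_vertical hq]
    simp

/-- The connection of a spray in coordinates. -/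
theorem conn_coord (hS : A.IsSprayCoord w₀ V S) (hq : q ∈ coordSet EM w₀ V)
    {ρ : ProlField EM F E} (hρ : DifferentiableAt ℝ (fstC w₀ ρ) q)
    (hm : (sndC w₀ ρ q).1 = A.anchorC w₀.proj q.1 (fstC w₀ ρ q)) :
    fstC w₀ (A.conn S ρ) q = fstC w₀ ρ q ∧
    sndC w₀ (A.conn S ρ) q = (A.anchorC w₀.proj q.1 (fstC w₀ ρ q),
      fderiv ℝ (fun q ↦ (sndC w₀ S q).2) q (0, fstC w₀ ρ q) - (sndC w₀ ρ q).2 +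
        A.structC w₀.proj q.1 q.2 (fstC w₀ ρ q)) := by
  obtain ⟨hb1, hb2⟩ := hS.bracket_vertical hq hρ (ρ := vertEndo EM ρ)
    (fun q _ ↦ fstC_vertEndo ρ) (fun q hq ↦ sndC_vertEndo ρ hq.1)
  have hf := hS.hasFDerivAt_fst hq
  have hb3 := A.fstC_prolBracket hq.1 (hS.subset hq.2) hf.differentiableAt hρ
      (by rw [hS.snd_fst_eq hq, hS.fst_eq q hq]) hm
  rw [hf.fderiv, hS.fst_eq q hq] at hb3
  have e1 : fstC w₀ (A.conn S ρ) q = - fstC w₀ (A.prolBracket S (vertEndo EM ρ)) q +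
      fstC w₀ (vertEndo EM (A.prolBracket S ρ)) q := by
    rw [← fstC_neg, ← fstC_add]; rfl
  have e2 : sndC w₀ (A.conn S ρ) q = - sndC w₀ (A.prolBracket S (vertEndo EM ρ)) q +
      sndC w₀ (vertEndo EM (A.prolBracket S ρ)) q := by
    rw [← sndC_neg, ← sndC_add]; rfl
  -- The derivative of `z` along `S` occurs in both brackets with opposite signs, so `𝒩` is of order
  -- zero in `ρ`.
  rw [e1, e2, hb1, hb2, fstC_vertEndo, sndC_vertEndo _ hq.1, hb3]
  refine ⟨by simp, Prod.ext (by simp) ?_⟩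
  simp only [Prod.snd_add, Prod.snd_neg, ContinuousLinearMap.coe_snd']
  abel

theorem isSectionOn_conn (hS : A.IsSprayCoord w₀ V S) {ρ : ProlField EM F E}
    (hρ : A.IsSectionOn V ρ) : A.IsSectionOn V (A.conn S ρ) := by
  obtain ⟨hm, hf, hs⟩ := (A.isSectionOn_iff ρ hS.isOpen hS.subset).1 hρ
  have hΩ := hS.isOpen_coordSet
  have hc := fun q hq ↦ hS.conn_coord (q := q) hq (differentiableAt_of_contDiffOn hf hΩ hq) (hm q hq)
  rw [A.isSectionOn_iff _ hS.isOpen hS.subset]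
  refine ⟨fun q hq ↦ by rw [(hc q hq).1, (hc q hq).2], hf.congr fun q hq ↦ (hc q hq).1,
    ContDiffOn.congr ?_ fun q hq ↦ (hc q hq).2⟩
  refine ((A.contDiffOn_anchorC_fst hS.subset).clm_apply hf).prodMk (ContDiffOn.add
    (ContDiffOn.sub ?_ hs.snd) (((A.contDiffOn_structC_fst hS.subset).clm_apply
      _root_.contDiffOn_snd).clm_apply hf))
  exact (contDiffOn_fderiv_top hS.contDiffOn_snd.snd hΩ).clm_apply (contDiffOn_const.prodMk hf)

/-- The dynamical covariant derivative of a vertical section in coordinates. -/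
theorem dynCovDeriv_coord (hS : A.IsSprayCoord w₀ V S) {ρ : ProlField EM F E}
    (hρ : A.IsSectionOn V ρ) (hvert : ∀ w ∈ V, (ρ w).1 = 0) (hq : q ∈ coordSet EM w₀ V) :
    sndC w₀ (A.dynCovDeriv S (A.conn S) ρ) q =
      (0, fderiv ℝ (fun q ↦ (sndC w₀ ρ q).2) q (sndC w₀ S q) +
        (1 / 2 : ℝ) • (A.structC w₀.proj q.1 q.2 (sndC w₀ ρ q).2 -
          fderiv ℝ (fun q ↦ (sndC w₀ S q).2) q (0, (sndC w₀ ρ q).2))) := by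
  obtain ⟨hm, hf, hs⟩ := (A.isSectionOn_iff ρ hS.isOpen hS.subset).1 hρ
  have hΩ := hS.isOpen_coordSet
  have hf0 : ∀ q ∈ coordSet EM w₀ V, fstC w₀ ρ q = 0 := fun q hq ↦ by
    rw [fstC, hvert _ hq.2, map_zero]
  have hs0 : ∀ q ∈ coordSet EM w₀ V, sndC w₀ ρ q = (0, (sndC w₀ ρ q).2) := fun q hq ↦
    Prod.ext (by rw [hm q hq, hf0 q hq, map_zero]) rfl
  -- On vertical sections `𝒩 = -Id`. Hence `hρ = 0` and `vρ = ρ`, and only `v[S, ρ]` contributes to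
  -- `∇ρ`.
  have hP : ∀ q ∈ coordSet EM w₀ V, fstC w₀ (A.conn S ρ) q = 0 ∧
      sndC w₀ (A.conn S ρ) q = (0, -(sndC w₀ ρ q).2) := by
    intro q hq
    obtain ⟨h1, h2⟩ := hS.conn_coord hq (differentiableAt_of_contDiffOn hf hΩ hq) (hm q hq)
    rw [hf0 q hq] at h1 h2
    exact ⟨h1, by rw [h2]; simp; exact map_zero _⟩
  have hH : ∀ q ∈ coordSet EM w₀ V, fstC w₀ (A.prolBracket S (hproj (A.conn S) ρ)) q = 0 ∧
      sndC w₀ (A.prolBracket S (hproj (A.conn S) ρ)) q = 0 := by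
    intro q hq
    obtain ⟨h1, h2⟩ := hS.bracket_vertical hq (v := fun _ ↦ 0) (differentiableAt_const _)
      (ρ := hproj (A.conn S) ρ)
      (fun q hq ↦ by rw [fstC_hproj, hf0 q hq, (hP q hq).1]; simp)
      (fun q hq ↦ by rw [sndC_hproj, hs0 q hq, (hP q hq).2]; simp)
    exact ⟨by rw [h1]; simp, by rw [h2]; simp; exact map_zero _⟩
  have hVb : ∀ q ∈ coordSet EM w₀ V, _ := fun q hq ↦ hS.bracket_vertical (q := q) hq
    (v := fun q ↦ (sndC w₀ ρ q).2) (differentiableAt_of_contDiffOn hs.snd hΩ hq)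
    (ρ := vproj (A.conn S) ρ)
    (fun q hq ↦ by rw [fstC_vproj, hf0 q hq, (hP q hq).1]; simp)
    (fun q hq ↦ by
      rw [sndC_vproj, (hP q hq).2, hs0 q hq, Prod.mk_sub_mk, sub_zero, sub_neg_eq_add, ← two_smul ℝ,
        Prod.smul_mk, smul_smul]
      norm_num)
  have hn := hΩ.mem_nhds hq
  have hd1 : DifferentiableAt ℝ (fstC w₀ (A.prolBracket S (hproj (A.conn S) ρ))) q :=
    (differentiableAt_const (0 : F)).congr_of_eventuallyEq
      (by filter_upwards [hn] with q' hq' using (hH q' hq').1)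
  have hd2 : DifferentiableAt ℝ (fstC w₀ (A.prolBracket S (vproj (A.conn S) ρ))) q :=
    (differentiableAt_of_contDiffOn hs.snd hΩ hq).neg.congr_of_eventuallyEq
      (by filter_upwards [hn] with q' hq' using (hVb q' hq').1)
  obtain ⟨-, c1⟩ := hS.conn_coord hq hd1 (by rw [(hH q hq).1, (hH q hq).2, map_zero]; rfl)
  obtain ⟨-, c2⟩ := hS.conn_coord hq hd2 (by rw [(hVb q hq).1, (hVb q hq).2, map_neg])
  have e : sndC w₀ (A.dynCovDeriv S (A.conn S) ρ) q =
      sndC w₀ (hproj (A.conn S) (A.prolBracket S (hproj (A.conn S) ρ))) q +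
      sndC w₀ (vproj (A.conn S) (A.prolBracket S (vproj (A.conn S) ρ))) q := by
    rw [← sndC_add]; rfl
  -- The bracket `[S, ρ]` has first component `-v` and fibre part `S(v) - ∂s(v)`. Applying `½(Id -
  -- 𝒩)` adds `½(∂s(v) + c(y, v))`, which halves the correction.
  rw [e, sndC_hproj, sndC_vproj, c1, c2, (hH q hq).1, (hH q hq).2, (hVb q hq).1, (hVb q hq).2]
  have hneg : ((0, -(sndC w₀ ρ q).2) : EM × F) = -(0, (sndC w₀ ρ q).2) := by simp
  rw [hneg, map_neg, map_neg, map_neg]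
  refine Prod.ext (by simp) ?_
  simp only [map_zero, Prod.mk_zero_zero, Prod.snd_add, Prod.smul_snd, Prod.snd_sub, Prod.snd_zero]
  module

end IsSprayCoord

theorem metric_coord (hL : ContDiffOn ℝ ∞ (funC EM w₀ L) (coordSet EM w₀ V)) (hVo : IsOpen V)
    (hq : q ∈ coordSet EM w₀ V) {ρ₁ ρ₂ : ProlField EM F E} (h1 : (sndC w₀ ρ₁ q).1 = 0)
    (h2 : (sndC w₀ ρ₂ q).1 = 0) :
    metric L ρ₁ ρ₂ ((totChart EM w₀).symm q) =
      fderiv ℝ (momentum (funC EM w₀ L)) q (0, (sndC w₀ ρ₁ q).2) (sndC w₀ ρ₂ q).2 := by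
  have hs := (totChart EM w₀).map_target hq.1
  rw [metric, fibreHess_eq hL hVo hq, fibCoord_vcomp hs h1, fibCoord_vcomp hs h2]
  rfl

theorem IsLagrangianSectionOn.isSprayCoord
    (hL : ContMDiffOn (𝓘(ℝ, EM).prod 𝓘(ℝ, F)) 𝓘(ℝ, ℝ) ∞ L U) (hreg : IsRegularOn L U)
    (hU : IsOpen U) (h : A.IsLagrangianSectionOn U L S) (w₀ : TotalSpace F E) :
    A.IsSprayCoord w₀ (U ∩ frameDom EM w₀) S where
  isOpen := isOpen_inter_frameDom hU w₀
  subset := inter_subset_right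
  isSectionOn := h.1.mono inter_subset_left
  fst_eq := fun q hq ↦ (((A.isLagrangianSectionOn_iff (hL.mono inter_subset_left)
    (fun w' hw' ↦ hreg w' hw'.1) (isOpen_inter_frameDom hU w₀) inter_subset_right S).1
      (h.mono inter_subset_left)).2 q hq).1

/-- To prove a pointwise statement on `U` it is enough to prove it in the coordinates centred at
the point. -/
theorem forall_mem_of_coord {p : TotalSpace F E → Prop}
    (h : ∀ w ∈ U, ∀ q ∈ coordSet EM w (U ∩ frameDom EM w), p ((totChart EM w).symm q)) :
    ∀ w ∈ U, p w := fun w hw ↦ by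
  have := h w hw _ (totChart_mem_coordSet hw)
  rwa [(totChart EM w).left_inv (mem_extChartAt_source w)] at this

theorem IsLagrangianSectionOn.isSemisprayOn
    (hL : ContMDiffOn (𝓘(ℝ, EM).prod 𝓘(ℝ, F)) 𝓘(ℝ, ℝ) ∞ L U) (hreg : IsRegularOn L U)
    (hU : IsOpen U) (h : A.IsLagrangianSectionOn U L S) : A.IsSemisprayOn U S := by
  refine ⟨h.1, forall_mem_of_coord (EM := EM) fun w hw q hq ↦ ?_⟩
  have hS := h.isSprayCoord hL hreg hU w
  refine ext_coord hq.1 (by rw [fstC_vertEndo, fstC_euler]) ?_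
  rw [sndC_vertEndo _ hq.1, sndC_euler hq.1, hS.fst_eq q hq]

/-- Only the semispray property enters: the form `(z, v) ↦ (z, ∂s(z) + c(y, z) - v)` is linear,
squares to the identity, and has `-1`-eigenspace `z = 0`. -/
theorem isConnectionOn_conn
    (hS : ∀ w₀ : TotalSpace F E, A.IsSprayCoord w₀ (U ∩ frameDom EM w₀) S) :
    A.IsConnectionOn U (A.conn S) := by
  have hsec : ∀ ρ, A.IsSectionOn U ρ → A.IsSectionOn U (A.conn S ρ) := fun ρ hρ ↦
    A.isSectionOn_of_local fun w hw ↦ ⟨_, (hS w).isOpen, ⟨hw, mem_frameDom_self w⟩,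
      (hS w).isSectionOn_conn (hρ.mono inter_subset_left)⟩
  have hc : ∀ {w : TotalSpace F E} {q : EM × F} (_ : q ∈ coordSet EM w (U ∩ frameDom EM w))
      {ρ : ProlField EM F E} (_ : A.IsSectionOn U ρ),
      (sndC w ρ q).1 = A.anchorC w.proj q.1 (fstC w ρ q) ∧
      DifferentiableAt ℝ (fstC w ρ) q := by
    intro w q hq ρ hρ
    obtain ⟨hm, hf, -⟩ := (A.isSectionOn_iff ρ (hS w).isOpen (hS w).subset).1
      (hρ.mono inter_subset_left)
    exact ⟨hm q hq, differentiableAt_of_contDiffOn hf (hS w).isOpen_coordSet hq⟩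
  refine ⟨hsec, fun ρ₁ ρ₂ h1 h2 ↦ ?_, fun f ρ hf hρ ↦ ?_, fun ρ hρ ↦ ?_, fun ρ hρ ↦ ?_⟩
  · refine forall_mem_of_coord (EM := EM) fun w hw q hq ↦ ?_
    obtain ⟨m1, d1⟩ := hc hq h1
    obtain ⟨m2, d2⟩ := hc hq h2
    have e : fstC w (fun w' ↦ ρ₁ w' + ρ₂ w') = fun q ↦ fstC w ρ₁ q + fstC w ρ₂ q :=
      funext fun q ↦ fstC_add ρ₁ ρ₂
    obtain ⟨a1, b1⟩ := (hS w).conn_coord hq d1 m1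
    obtain ⟨a2, b2⟩ := (hS w).conn_coord hq d2 m2
    obtain ⟨a3, b3⟩ := (hS w).conn_coord hq (ρ := fun w' ↦ ρ₁ w' + ρ₂ w')
      (by rw [e]; exact d1.add d2) (by rw [sndC_add, fstC_add, map_add, Prod.fst_add, m1, m2])
    refine ext_coord (ρ' := fun w' ↦ A.conn S ρ₁ w' + A.conn S ρ₂ w') hq.1 ?_ ?_
    · rw [a3, fstC_add, fstC_add, a1, a2]
    · rw [b3, sndC_add (A.conn S ρ₁) (A.conn S ρ₂), b1, b2, sndC_add ρ₁ ρ₂, fstC_add ρ₁ ρ₂]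
      have h0 : ((0, fstC w ρ₁ q + fstC w ρ₂ q) : EM × F) =
          (0, fstC w ρ₁ q) + (0, fstC w ρ₂ q) := by simp
      rw [h0, map_add, map_add, map_add]
      refine Prod.ext rfl ?_
      simp only [Prod.snd_add]
      abel
  · refine forall_mem_of_coord (EM := EM) fun w hw q hq ↦ ?_
    obtain ⟨m1, d1⟩ := hc hq hρ
    have df : DifferentiableAt ℝ (funC EM w f) q :=
      differentiableAt_of_contDiffOn (contDiffOn_funC (hf.mono inter_subset_left) (hS w).isOpen
        (hS w).subset) (hS w).isOpen_coordSet hq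
    have e : fstC w (fun w' ↦ f w' • ρ w') = fun q ↦ funC EM w f q • fstC w ρ q :=
      funext fun q ↦ fstC_smul f ρ
    obtain ⟨a1, b1⟩ := (hS w).conn_coord hq d1 m1
    obtain ⟨a3, b3⟩ := (hS w).conn_coord hq (ρ := fun w' ↦ f w' • ρ w')
      (by rw [e]; exact df.smul d1) (by rw [sndC_smul, fstC_smul, map_smul, Prod.smul_fst, m1])
    refine ext_coord (ρ' := fun w' ↦ f w' • A.conn S ρ w') hq.1 ?_ ?_
    · rw [a3, fstC_smul, fstC_smul, a1]
    · rw [b3, sndC_smul f (A.conn S ρ), b1, sndC_smul f ρ, fstC_smul f ρ]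
      have h0 : ((0, funC EM w f q • fstC w ρ q) : EM × F) = funC EM w f q • (0, fstC w ρ q) := by
        simp
      rw [h0, map_smul, map_smul, map_smul]
      refine Prod.ext rfl ?_
      simp only [Prod.smul_snd, smul_add, smul_sub]
  · refine forall_mem_of_coord (EM := EM) fun w hw q hq ↦ ?_
    obtain ⟨m1, d1⟩ := hc hq hρ
    obtain ⟨m2, d2⟩ := hc hq (hsec ρ hρ)
    obtain ⟨a1, b1⟩ := (hS w).conn_coord hq d1 m1
    obtain ⟨a2, b2⟩ := (hS w).conn_coord hq d2 m2
    refine ext_coord hq.1 (a2.trans a1) ?_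
    rw [b2, a1, b1]
    refine Prod.ext m1.symm ?_
    simp only
    abel
  · refine forall_mem_of_coord (EM := EM) (p := fun w ↦ A.conn S ρ w = - ρ w ↔ (ρ w).1 = 0)
      fun w hw q hq ↦ ?_
    obtain ⟨m1, d1⟩ := hc hq hρ
    obtain ⟨a1, b1⟩ := (hS w).conn_coord hq d1 m1
    constructor
    · intro h
      have h1 : fstC w (A.conn S ρ) q = - fstC w ρ q := by
        rw [fstC, h, Prod.fst_neg, map_neg]; rfl
      rw [a1] at h1
      have h2 : (2 : ℝ) • fstC w ρ q = 0 := by rw [two_smul]; exact add_eq_zero_iff_eq_neg.2 h1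
      exact fibCoord_injective (symm_proj_mem_baseSet hq.1)
        (((smul_eq_zero_iff_right two_ne_zero).1 h2).trans (map_zero _).symm)
    · intro h
      have h0 : fstC w ρ q = 0 := by rw [fstC, h, map_zero]
      refine ext_coord (ρ' := fun w' ↦ - ρ w') hq.1 ?_ ?_
      · rw [fstC_neg, a1, h0, neg_zero]
      · rw [sndC_neg, b1, h0]
        rw [h0, map_zero] at m1
        refine Prod.ext (by simp [m1]) ?_
        have h1 : ((0, 0) : EM × F) = 0 := rfl
        simp [h1]

theorem IsLagrangianSectionOn.isMetricOn
    (hL : ContMDiffOn (𝓘(ℝ, EM).prod 𝓘(ℝ, F)) 𝓘(ℝ, ℝ) ∞ L U) (hreg : IsRegularOn L U)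
    (hU : IsOpen U) (h : A.IsLagrangianSectionOn U L S) : A.IsMetricOn U L S (A.conn S) := by
  intro ρ₁ ρ₂ h1 h2 hv1 hv2
  refine forall_mem_of_coord (EM := EM) fun w hw q hq ↦ ?_
  have hS := h.isSprayCoord hL hreg hU w
  have hΩ := hS.isOpen_coordSet
  have hLc := contDiffOn_funC (hL.mono inter_subset_left) hS.isOpen hS.subset
  have hEL := fun q hq ↦ (((A.isLagrangianSectionOn_iff (hL.mono inter_subset_left)
    (fun w' hw' ↦ hreg w' hw'.1) hS.isOpen hS.subset S).1 (h.mono inter_subset_left)).2 q hq).2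
  have hvert : ∀ {ρ : ProlField EM F E}, A.IsSectionOn U ρ → (∀ w ∈ U, (ρ w).1 = 0) →
      ∀ q ∈ coordSet EM w (U ∩ frameDom EM w), (sndC w ρ q).1 = 0 := by
    intro ρ hρ hv q hq
    rw [((A.isSectionOn_iff ρ hS.isOpen hS.subset).1 (hρ.mono inter_subset_left)).1 q hq, fstC,
      hv _ hq.2.1, map_zero, map_zero]
  have hsm : ∀ {ρ : ProlField EM F E}, A.IsSectionOn U ρ →
      DifferentiableAt ℝ (fun q ↦ (sndC w ρ q).2) q := fun {ρ} hρ ↦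
    differentiableAt_of_contDiffOn ((A.isSectionOn_iff ρ hS.isOpen hS.subset).1
      (hρ.mono inter_subset_left)).2.2.snd hΩ hq
  have hn1 := hS.dynCovDeriv_coord (h1.mono inter_subset_left) (fun w hw ↦ hv1 w hw.1) hq
  have hn2 := hS.dynCovDeriv_coord (h2.mono inter_subset_left) (fun w hw ↦ hv2 w hw.1) hq
  -- This evaluates the derivative of the Hessian along `S`. By the product rule for `g(v₁, v₂)`,
  -- the terms `S(v₁)`, `S(v₂)` match those in `∇`, and the remaining half-corrections are this
  -- identity divided by two.
  have hid := EulerLagrangeAt.metric_identity (c := A.structC w.proj)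
    (fun x f f' ↦ A.structMap_skew _ _ f f') hLc hΩ (hS.differentiableAt_snd hq).snd hEL hq (sndC w ρ₁ q).2 (sndC w ρ₂ q).2
  have hg := differentiableAt_of_contDiffOn (contDiffOn_fderiv_top (contDiffOn_momentum hLc hΩ) hΩ)
    hΩ hq
  have hd := ((hg.hasFDerivAt.clm_apply ((hasFDerivAt_const (0 : EM) q).prodMk
    (hsm h1).hasFDerivAt)).clm_apply (hsm h2).hasFDerivAt).congr_of_eventuallyEq
    (f₁ := metric L ρ₁ ρ₂ ∘ (totChart EM w).symm) (by
      filter_upwards [hΩ.mem_nhds hq] with q' hq'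
      exact metric_coord hLc hS.isOpen hq' (hvert h1 hv1 q' hq') (hvert h2 hv2 q' hq'))
  have hX : ((A.anchorC w.proj q.1 q.2, (sndC w S q).2) : EM × F) = sndC w S q :=
    Prod.ext (hS.snd_fst_eq hq).symm rfl
  rw [dynCovDerivMetric, dirDeriv_eq hq.1 hd.differentiableAt, hd.fderiv,
    metric_coord hLc hS.isOpen hq (by rw [hn1]) (hvert h2 hv2 q hq),
    metric_coord hLc hS.isOpen hq (hvert h1 hv1 q hq) (by rw [hn2]), hn1, hn2]
  rw [hX] at hid
  have hsplit : ∀ a b : F, ((0, a + (1 / 2 : ℝ) • b) : EM × F) =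
      (0, a) + (1 / 2 : ℝ) • (0, b) := fun a b ↦ by simp
  simp only [hsplit, map_add, map_smul, add_apply, smul_apply, smul_eq_mul]
  rw [show totD w ((totChart EM w).symm q) (S ((totChart EM w).symm q)).2 = sndC w S q from rfl]
  simp only [add_apply, ContinuousLinearMap.comp_apply, ContinuousLinearMap.flip_apply,
    ContinuousLinearMap.prod_apply, zero_apply]
  linarith

end Connection

end LieAlgebroid

end

theorem theorem1p4p1
    {EM : Type*} [NormedAddCommGroup EM] [NormedSpace ℝ EM] [FiniteDimensional ℝ EM]
    {M : Type*} [TopologicalSpace M] [T2Space M] [ChartedSpace EM M] [IsManifold 𝓘(ℝ, EM) ∞ M]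
    {F : Type*} [NormedAddCommGroup F] [NormedSpace ℝ F] [FiniteDimensional ℝ F]
    {E : M → Type*} [TopologicalSpace (TotalSpace F E)]
    [∀ x, AddCommGroup (E x)] [∀ x, Module ℝ (E x)] [∀ x, TopologicalSpace (E x)]
    [FiberBundle F E] [VectorBundle ℝ F E] [ContMDiffVectorBundle ∞ F E 𝓘(ℝ, EM)]
    (A : LieAlgebroid EM F E)
    (U : Set (TotalSpace F E)) (hU : IsOpen U)
    (L : TotalSpace F E → ℝ)
    (hL : ContMDiffOn (𝓘(ℝ, EM).prod 𝓘(ℝ, F)) 𝓘(ℝ, ℝ) ∞ L U)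
    (hreg : LieAlgebroid.IsRegularOn L U) :
    (∃ S : LieAlgebroid.ProlField EM F E, A.IsLagrangianSectionOn U L S) ∧
    ∀ S : LieAlgebroid.ProlField EM F E, A.IsLagrangianSectionOn U L S →
      (∀ S' : LieAlgebroid.ProlField EM F E, A.IsLagrangianSectionOn U L S' → ∀ w ∈ U, S' w = S w) ∧
      A.IsSemisprayOn U S ∧
      A.IsConnectionOn U (A.conn S) ∧
      A.IsMetricOn U L S (A.conn S) := by
  refine ⟨A.exists_isLagrangianSectionOn hL hreg hU, fun S hS ↦ ⟨fun S' hS' w hw ↦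
    hS.unique hL hreg hU hS' hw, hS.isSemisprayOn hL hreg hU, ?_, hS.isMetricOn hL hreg hU⟩⟩
  exact LieAlgebroid.isConnectionOn_conn fun w₀ ↦ hS.isSprayCoord hL hreg hU w₀
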